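/- Let $G$ be a finite group. A \emph{CDGA} is a graded-commutative differential graded $\mathbb Q$-algebra in degrees $\ge 0$, and a \emph{DGA diagram} is a covariant functor from the orbit category $\mathcal O_G$ (objects the $G$-sets $G/H$ with $H\le G$, morphisms the $G$-maps) to CDGAs. A DGA diagram is a \emph{system of DGAs} if its underlying functor to rational vector spaces is an injective object of the functor category. A map of DGA diagrams is a quasi-isomorphism if it is one at every $G/H$. \emph{Weak equivalence} of systems of DGAs is the equivalence relation generated by quasi-isomorphisms between systems of DGAs. Two CDGAs have \emph{the same rational homotopy type} if they are connected by a finite zig-zag of quasi-isomorphisms of CDGAs. A CDGA is a \emph{minimal algebra} if it is free as a graded-commutative algebra on generators of degrees $\ge 2$, and the differential of a generator of degree $n$ lies in the subalgebra generated by the generators of degree $<n$. For a DGA diagram $\mathcal A$ and $H\le G$ let $V_H\subseteq\mathcal A(G/H)$ be the intersection of the kernels of the maps $\mathcal A(G/H)\to\mathcal A(G/H')$ induced by the projections with $H\subsetneq H'$, and let $\underline V_H^*(G/K)=\operatorname{Hom}_{\mathbb Q(N(H)/H)}(\mathbb Q(G/H)^K,V_H)$. The \emph{enlargement} of $\mathcal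 A$ at $H$ is, at $G/K$, the algebra $\mathcal A(G/K)\otimes\Lambda\big(\underline V_H^*(G/K)\oplus s\underline V_H^*(G/K)\big)$ with $d v=s v$ if $K$ is a proper subgroup of a conjugate of $H$, and $\mathcal A(G/K)$ otherwise; its structure maps extend those of $\mathcal A$ and $\underline V_H^*$, with $\underline V_H^*(G/H)\cong V_H\subseteq\mathcal A(G/H)$. The \emph{injective envelope} $\mathcal I_{\mathcal A}$, with its inclusion $i_{\mathcal A}:\mathcal A\to\mathcal I_{\mathcal A}$, is obtained by successive enlargements at representatives of all conjugacy classes of subgroups, larger subgroups first, in some fixed order. Let $\mathcal M$ and $\mathcal N$ be DGA diagrams over $G$ such that, for every $H\le G$, $\mathcal M(G/H)$ and $\mathcal N(G/H)$ are minimal algebras with isomorphic cohomology algebras. (1) If $\mathcal I_{\mathcal M}$ and $\mathcal I_{\mathcal N}$ are weakly equivalent, then for every $H\le G$ the algebras $\mathcal M(G/H)$ and $\mathcal N(G/H)$ have the same rational homotopy type. (2) Conversely, let $r:\mathcal M\to\mathcal N$ be a map of DGA diagrams such that $r(G/H)$ is a quasi-isomorphism for every $H\le G$. Then there is a quasi-isomorphism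 $\varphi:\mathcal I_{\mathcal M}\to\mathcal I_{\mathcal N}$ with $\varphi\, i_{\mathcal M}=i_{\mathcal N}\, r$, and $\mathcal I_{\mathcal M}$ and $\mathcal I_{\mathcal N}$ are weakly equivalent. -/

import Mathlib

open CategoryTheory TensorProduct

universe u

/-- The free graded-commutative `ℚ`-algebra is a quotient of the free associative algebra on the
homogeneous generators by the following relations. (Over `ℚ` graded commutativity makes the
square of an odd element vanish.) -/
inductive FreeCGARel {ι : Type} (deg : ι → ℕ) (W : ι → Type u) [∀ i, AddCommGroup (W i)]
    [∀ i, Module ℚ (W i)] :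
    FreeAlgebra ℚ (Σ i, W i) → FreeAlgebra ℚ (Σ i, W i) → Prop
  | add (i : ι) (v w : W i) : FreeCGARel deg W (FreeAlgebra.ι ℚ ⟨i, v + w⟩)
      (FreeAlgebra.ι ℚ ⟨i, v⟩ + FreeAlgebra.ι ℚ ⟨i, w⟩)
  | smul (i : ι) (c : ℚ) (v : W i) : FreeCGARel deg W (FreeAlgebra.ι ℚ ⟨i, c • v⟩)
      (c • FreeAlgebra.ι ℚ ⟨i, v⟩)
  | comm (i j : ι) (v : W i) (w : W j) : FreeCGARel deg W
      (FreeAlgebra.ι ℚ ⟨i, v⟩ * FreeAlgebra.ι ℚ ⟨j, w⟩)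
      ((-1 : ℚ) ^ (deg i * deg j) • (FreeAlgebra.ι ℚ ⟨j, w⟩ * FreeAlgebra.ι ℚ ⟨i, v⟩))

/-- The free graded-commutative algebra on a family of vector spaces `W i`, with `W i` placed in
degree `deg i`. -/
abbrev FreeCGA {ι : Type} (deg : ι → ℕ) (W : ι → Type u) [∀ i, AddCommGroup (W i)]
    [∀ i, Module ℚ (W i)] : Type u :=
  RingQuot (FreeCGARel deg W)

namespace FreeCGA

variable {ι : Type} (deg : ι → ℕ) (W : ι → Type u) [∀ i, AddCommGroup (W i)]
  [∀ i, Module ℚ (W i)]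

/-- The inclusion of the generators. -/
noncomputable def gen (i : ι) : W i →ₗ[ℚ] FreeCGA deg W where
  toFun v := RingQuot.mkAlgHom ℚ (FreeCGARel deg W) (FreeAlgebra.ι ℚ ⟨i, v⟩)
  map_add' v w := by
    rw [RingQuot.mkAlgHom_rel ℚ (FreeCGARel.add i v w), map_add]
  map_smul' c v := by
    rw [RingQuot.mkAlgHom_rel ℚ (FreeCGARel.smul i c v), map_smul, RingHom.id_apply]

theorem gen_comm (i j : ι) (v : W i) (w : W j) :
    gen deg W i v * gen deg W j w
      = (-1 : ℚ) ^ (deg i * deg j) • (gen deg W j w * gen deg W i v) := by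
  have := RingQuot.mkAlgHom_rel ℚ (FreeCGARel.comm (deg := deg) i j v w)
  rw [map_mul, map_smul, map_mul] at this
  exact this

section lift
variable {deg W} {B : Type*} [Semiring B] [Algebra ℚ B]

/-- The universal property of the free graded-commutative algebra. -/
noncomputable def lift (g : ∀ i, W i →ₗ[ℚ] B)
    (hg : ∀ i j v w, g i v * g j w = (-1 : ℚ) ^ (deg i * deg j) • (g j w * g i v)) :
    FreeCGA deg W →ₐ[ℚ] B :=
  RingQuot.liftAlgHom ℚ ⟨FreeAlgebra.lift ℚ (fun x => g x.1 x.2), by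
    intro x y h
    cases h with
    | add i v w => simp
    | smul i c v => simp
    | comm i j v w => simpa using hg i j v w⟩

@[simp] theorem lift_gen (g : ∀ i, W i →ₗ[ℚ] B)
    (hg : ∀ i j v w, g i v * g j w = (-1 : ℚ) ^ (deg i * deg j) • (g j w * g i v))
    (i : ι) (v : W i) : lift g hg (gen deg W i v) = g i v := by
  simp [lift, gen]

theorem algHom_ext {f g : FreeCGA deg W →ₐ[ℚ] B}
    (h : ∀ i v, f (gen deg W i v) = g (gen deg W i v)) : f = g := by
  apply RingQuot.ringQuot_ext'
  apply FreeAlgebra.hom_ext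
  funext x
  exact h x.1 x.2

end lift

/-- The product of a word of generators. -/
noncomputable def word (l : List (Σ i, W i)) : FreeCGA deg W :=
  (l.map fun x => gen deg W x.1 x.2).prod

/-- The degree of a word of generators. -/
def wdeg (l : List (Σ i, W i)) : ℕ := (l.map fun x => deg x.1).sum

/-- The degree `n` part is spanned by the words of total degree `n`. -/
def gr (n : ℕ) : Submodule ℚ (FreeCGA deg W) :=
  Submodule.span ℚ {y | ∃ l : List (Σ i, W i), wdeg deg W l = n ∧ word deg W l = y}

theorem word_mem (l : List (Σ i, W i)) : word deg W l ∈ gr deg W (wdeg deg W l) :=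
  Submodule.subset_span ⟨l, rfl, rfl⟩

theorem gen_mem (i : ι) (v : W i) : gen deg W i v ∈ gr deg W (deg i) :=
  Submodule.subset_span ⟨[⟨i, v⟩], by simp [wdeg], by simp [word]⟩

instance gradedMonoid : SetLike.GradedMonoid (gr deg W) where
  one_mem := Submodule.subset_span ⟨[], by simp [wdeg], by simp [word]⟩
  mul_mem := by
    intro m n x y hx hy
    induction hx, hy using Submodule.span_induction₂ with
    | mem_mem x y hx hy =>
      obtain ⟨l, rfl, rfl⟩ := hx
      obtain ⟨k, rfl, rfl⟩ := hy
      exact Submodule.subset_span ⟨l ++ k, by simp [wdeg], by simp [word]⟩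
    | zero_left y hy => simp
    | zero_right y hy => simp
    | add_left x y z _ _ _ h1 h2 => rw [add_mul]; exact add_mem h1 h2
    | add_right x y z _ _ _ h1 h2 => rw [mul_add]; exact add_mem h1 h2
    | smul_left r x y _ _ h => rw [smul_mul_assoc]; exact Submodule.smul_mem _ _ h
    | smul_right r x y _ _ h => rw [mul_smul_comm]; exact Submodule.smul_mem _ _ h

theorem gen_word_comm (i : ι) (v : W i) (l : List (Σ i, W i)) :
    gen deg W i v * word deg W l
      = (-1 : ℚ) ^ (deg i * wdeg deg W l) • (word deg W l * gen deg W i v) := by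
  induction l with
  | nil => simp [word, wdeg]
  | cons x l ih =>
    have h1 : word deg W (x :: l) = gen deg W x.1 x.2 * word deg W l := by simp [word]
    have h2 : wdeg deg W (x :: l) = deg x.1 + wdeg deg W l := by simp [wdeg]
    rw [h1, h2, ← mul_assoc, gen_comm, smul_mul_assoc, mul_assoc, ih, mul_smul_comm, smul_smul,
      ← pow_add, ← mul_assoc, mul_add]

theorem gr_comm {m n : ℕ} {x y : FreeCGA deg W} (hx : x ∈ gr deg W m) (hy : y ∈ gr deg W n) :
    x * y = (-1 : ℚ) ^ (m * n) • (y * x) := by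
  induction hx, hy using Submodule.span_induction₂ with
  | mem_mem x y hx hy =>
    obtain ⟨l, rfl, rfl⟩ := hx
    obtain ⟨k, rfl, rfl⟩ := hy
    induction l with
    | nil => simp [word, wdeg]
    | cons x l ih =>
      have h1 : word deg W (x :: l) = gen deg W x.1 x.2 * word deg W l := by simp [word]
      have h2 : wdeg deg W (x :: l) = deg x.1 + wdeg deg W l := by simp [wdeg]
      rw [h1, h2, mul_assoc, ih, mul_smul_comm, ← mul_assoc, gen_word_comm, smul_mul_assoc,
        smul_smul, ← pow_add, mul_assoc, add_mul, add_comm]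
  | zero_left y hy => simp
  | zero_right y hy => simp
  | add_left x y z _ _ _ h1 h2 => rw [add_mul, h1, h2, mul_add, smul_add]
  | add_right x y z _ _ _ h1 h2 => rw [mul_add, h1, h2, add_mul, smul_add]
  | smul_left r x y _ _ h => rw [smul_mul_assoc, h, mul_smul_comm, smul_comm]
  | smul_right r x y _ _ h => rw [mul_smul_comm, h, smul_mul_assoc, smul_comm]

theorem lof_mul_lof {m n k : ℕ} (x : gr deg W m) (y : gr deg W n) (z : gr deg W k)
    (hk : m + n = k) (h : (x : FreeCGA deg W) * y = z) :
    DirectSum.lof ℚ ℕ (fun n => gr deg W n) m x * DirectSum.lof ℚ ℕ (fun n => gr deg W n) n y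
      = DirectSum.lof ℚ ℕ (fun n => gr deg W n) k z := by
  rw [DirectSum.lof_eq_of, DirectSum.lof_eq_of, DirectSum.lof_eq_of, DirectSum.of_mul_of]
  exact DirectSum.of_eq_of_gradedMonoid_eq (Sigma.subtype_ext hk h)

/-- The decomposition into homogeneous parts on generators. -/
noncomputable def decompGen (i : ι) : W i →ₗ[ℚ] DirectSum ℕ (fun n => gr deg W n) :=
  (DirectSum.lof ℚ ℕ (fun n => gr deg W n) (deg i)).comp
    ((gen deg W i).codRestrict (gr deg W (deg i)) (gen_mem deg W i))

theorem decompGen_comm (i j : ι) (v : W i) (w : W j) :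
    decompGen deg W i v * decompGen deg W j w
      = (-1 : ℚ) ^ (deg i * deg j) • (decompGen deg W j w * decompGen deg W i v) := by
  refine (lof_mul_lof deg W _ _ ((-1 : ℚ) ^ (deg i * deg j) •
    ⟨gen deg W j w * gen deg W i v, SetLike.mul_mem_graded (gen_mem deg W j w)
      (gen_mem deg W i v)⟩) (add_comm _ _) (gen_comm deg W i j v w)).trans ?_
  rw [map_smul]
  congr 1
  exact (lof_mul_lof deg W _ _ _ rfl rfl).symm

/-- The decomposition into homogeneous parts. -/
noncomputable def decomp : FreeCGA deg W →ₐ[ℚ] DirectSum ℕ (fun n => gr deg W n) :=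
  lift (deg := deg) (W := W) (decompGen deg W) (decompGen_comm deg W)

theorem decomp_gen (i : ι) (v : W i) : decomp deg W (gen deg W i v) =
    DirectSum.lof ℚ ℕ (fun n => gr deg W n) (deg i) ⟨gen deg W i v, gen_mem deg W i v⟩ :=
  lift_gen (deg := deg) (W := W) (decompGen deg W) (decompGen_comm deg W) i v

theorem decomp_word (l : List (Σ i, W i)) :
    decomp deg W (word deg W l) =
      DirectSum.lof ℚ ℕ (fun n => gr deg W n) (wdeg deg W l) ⟨word deg W l, word_mem deg W l⟩ := by
  induction l with
  | nil =>
    have : word deg W [] = 1 := by simp [word]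
    rw [DirectSum.lof_eq_of]
    simp only [this, map_one]
    rfl
  | cons x l ih =>
    have h1 : word deg W (x :: l) = gen deg W x.1 x.2 * word deg W l := by simp [word]
    have h2 : wdeg deg W (x :: l) = deg x.1 + wdeg deg W l := by simp [wdeg]
    have h3 : decomp deg W (word deg W (x :: l))
        = decomp deg W (gen deg W x.1 x.2) * decomp deg W (word deg W l) := by rw [h1, map_mul]
    rw [h3, ih, decomp_gen]
    exact lof_mul_lof deg W _ _ _ h2.symm h1.symm

noncomputable instance gradedAlgebra : GradedAlgebra (gr deg W) :=
  GradedAlgebra.ofAlgHom (gr deg W) (decomp deg W)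
    (by
      apply algHom_ext (deg := deg) (W := W)
      intro i v
      rw [AlgHom.comp_apply, decomp_gen, DirectSum.lof_eq_of,
        DirectSum.coeAlgHom_of]
      rfl)
    (by
      rintro n ⟨x, hx⟩
      rw [← DirectSum.lof_eq_of ℚ]
      induction hx using Submodule.span_induction with
      | mem x h =>
        obtain ⟨l, rfl, rfl⟩ := h
        exact decomp_word deg W l
      | zero =>
        have : (⟨0, Submodule.zero_mem _⟩ : gr deg W n) = 0 := rfl
        simp only [map_zero]
        exact (map_zero (DirectSum.lof ℚ ℕ (fun n => gr deg W n) n)).symm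
      | add x y hx hy h1 h2 =>
        simp only [map_add] at *
        rw [h1, h2, ← map_add]; rfl
      | smul c x hx h =>
        simp only [map_smul] at *
        rw [h, ← map_smul]; rfl)

end FreeCGA

namespace FreeCGA

variable {ι : Type} (deg : ι → ℕ) (W : ι → Type u) [∀ i, AddCommGroup (W i)]
  [∀ i, Module ℚ (W i)]

section deriv

variable (δ : ∀ i, W i →ₗ[ℚ] FreeCGA deg W)

/-- The map `v ↦ (± v, δ v; 0, v)` on generators. -/
noncomputable def derivGen (i : ι) : W i →ₗ[ℚ] Matrix (Fin 2) (Fin 2) (FreeCGA deg W) where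
  toFun v := !![(-1 : ℚ) ^ deg i • gen deg W i v, δ i v; 0, gen deg W i v]
  map_add' v w := by
    ext a b
    fin_cases a <;> fin_cases b <;> simp
  map_smul' c v := by
    ext a b
    fin_cases a <;> fin_cases b <;> simp [smul_comm c]

theorem derivGen_comm (hδ : ∀ i v, δ i v ∈ gr deg W (deg i + 1))
    (i j : ι) (v : W i) (w : W j) :
    derivGen deg W δ i v * derivGen deg W δ j w
      = (-1 : ℚ) ^ (deg i * deg j) • (derivGen deg W δ j w * derivGen deg W δ i v) := by
  have h1 := gen_comm deg W i j v w
  have h2 := gr_comm deg W (gen_mem deg W i v) (hδ j w)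
  have h3 := gr_comm deg W (hδ i v) (gen_mem deg W j w)
  have e1 : ((-1 : ℚ) ^ deg i) * (-1) ^ (deg i * (deg j + 1)) = (-1) ^ (deg i * deg j) := by
    rw [← pow_add, show deg i + deg i * (deg j + 1) = deg i * deg j + 2 * deg i by ring, pow_add,
      pow_mul]
    simp
  have e2 : ((-1 : ℚ) ^ ((deg i + 1) * deg j)) = (-1) ^ (deg i * deg j) * (-1) ^ deg j := by
    rw [← pow_add]; congr 1; ring
  ext a b
  fin_cases a <;> fin_cases b
  · simp [derivGen, Matrix.mul_apply, Fin.sum_univ_two, h1, smul_smul]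
    congr 1; ring
  · simp [derivGen, Matrix.mul_apply, Fin.sum_univ_two, h2, h3, smul_smul, e1, e2]
    abel
  · simp [derivGen, Matrix.mul_apply, Fin.sum_univ_two]
  · simpa [derivGen, Matrix.mul_apply, Fin.sum_univ_two] using h1

variable (hδ : ∀ i v, δ i v ∈ gr deg W (deg i + 1))

/-- The algebra map `x ↦ (± x, d x; 0, x)` whose upper right entry is the derivation extending
`δ`. -/
noncomputable def derivHom : FreeCGA deg W →ₐ[ℚ] Matrix (Fin 2) (Fin 2) (FreeCGA deg W) :=
  lift (deg := deg) (W := W) (derivGen deg W δ) (derivGen_comm deg W δ hδ)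

/-- The (graded) derivation of degree `1` which extends `δ`. -/
noncomputable def deriv : FreeCGA deg W →ₗ[ℚ] FreeCGA deg W where
  toFun x := derivHom deg W δ hδ x 0 1
  map_add' x y := by rw [map_add]; rfl
  map_smul' c x := by rw [map_smul]; rfl

theorem derivHom_gen (i : ι) (v : W i) :
    derivHom deg W δ hδ (gen deg W i v) = derivGen deg W δ i v :=
  lift_gen (deg := deg) (W := W) (derivGen deg W δ) (derivGen_comm deg W δ hδ) i v

theorem deriv_gen (i : ι) (v : W i) : deriv deg W δ hδ (gen deg W i v) = δ i v := by
  change derivHom deg W δ hδ (gen deg W i v) 0 1 = _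
  rw [derivHom_gen]; rfl

theorem derivHom_spec {n : ℕ} {x : FreeCGA deg W} (hx : x ∈ gr deg W n) :
    derivHom deg W δ hδ x 0 0 = (-1 : ℚ) ^ n • x ∧ derivHom deg W δ hδ x 1 0 = 0 ∧
      derivHom deg W δ hδ x 1 1 = x ∧ derivHom deg W δ hδ x 0 1 ∈ gr deg W (n + 1) := by
  induction hx using Submodule.span_induction with
  | mem x h =>
    obtain ⟨l, rfl, rfl⟩ := h
    induction l with
    | nil => simp [word, wdeg]
    | cons x l ih =>
      obtain ⟨i1, i2, i3, i4⟩ := ih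
      have h1 : word deg W (x :: l) = gen deg W x.1 x.2 * word deg W l := by simp [word]
      have h2 : wdeg deg W (x :: l) = deg x.1 + wdeg deg W l := by simp [wdeg]
      rw [h1, h2, map_mul, derivHom_gen]
      refine ⟨?_, ?_, ?_, ?_⟩
      · simp [Matrix.mul_apply, Fin.sum_univ_two, i1, i2, derivGen, smul_smul, pow_add, mul_comm]
      · simp [Matrix.mul_apply, Fin.sum_univ_two, i2, derivGen]
      · simp [Matrix.mul_apply, Fin.sum_univ_two, i3, derivGen]
      · simp only [Matrix.mul_apply, Fin.sum_univ_two, i3]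
        refine add_mem ?_ ?_
        · have := SetLike.mul_mem_graded (A := gr deg W)
            (Submodule.smul_mem _ ((-1 : ℚ) ^ deg x.1) (gen_mem deg W x.1 x.2)) i4
          simpa [derivGen, add_assoc] using this
        · have := SetLike.mul_mem_graded (A := gr deg W) (hδ x.1 x.2) (word_mem deg W l)
          rw [show deg x.1 + wdeg deg W l + 1 = deg x.1 + 1 + wdeg deg W l by ring]
          exact this
  | zero => simp
  | add x y _ _ h1 h2 =>
    obtain ⟨a1, a2, a3, a4⟩ := h1
    obtain ⟨b1, b2, b3, b4⟩ := h2
    rw [map_add]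
    simp only [Matrix.add_apply, a1, a2, a3, b1, b2, b3, smul_add, add_zero, true_and]
    exact add_mem a4 b4
  | smul c x _ h =>
    obtain ⟨a1, a2, a3, a4⟩ := h
    rw [map_smul]
    simp only [Matrix.smul_apply, a1, a2, a3, smul_zero, true_and]
    exact ⟨smul_comm _ _ _, Submodule.smul_mem _ _ a4⟩

theorem deriv_mem {n : ℕ} {x : FreeCGA deg W} (hx : x ∈ gr deg W n) :
    deriv deg W δ hδ x ∈ gr deg W (n + 1) :=
  (derivHom_spec deg W δ hδ hx).2.2.2

theorem deriv_mul {m n : ℕ} {x y : FreeCGA deg W} (hx : x ∈ gr deg W m) (hy : y ∈ gr deg W n) :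
    deriv deg W δ hδ (x * y)
      = deriv deg W δ hδ x * y + (-1 : ℚ) ^ m • (x * deriv deg W δ hδ y) := by
  change derivHom deg W δ hδ (x * y) 0 1 = derivHom deg W δ hδ x 0 1 * y
    + (-1 : ℚ) ^ m • (x * derivHom deg W δ hδ y 0 1)
  rw [map_mul, Matrix.mul_apply, Fin.sum_univ_two, (derivHom_spec deg W δ hδ hx).1,
    (derivHom_spec deg W δ hδ hy).2.2.1, smul_mul_assoc, add_comm]

/-- A derivation of degree `1` that squares to zero on the generators squares to zero. -/
theorem deriv_deriv (h0 : ∀ i v, deriv deg W δ hδ (δ i v) = 0) (x : FreeCGA deg W) :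
    deriv deg W δ hδ (deriv deg W δ hδ x) = 0 := by
  have key : ∀ n, ∀ x ∈ gr deg W n, deriv deg W δ hδ (deriv deg W δ hδ x) = 0 := by
    intro n x hx
    induction hx using Submodule.span_induction with
    | mem x h =>
      obtain ⟨l, rfl, rfl⟩ := h
      induction l with
      | nil =>
        have : deriv deg W δ hδ (word deg W []) = 0 := by
          change derivHom deg W δ hδ (word deg W []) 0 1 = 0
          simp [word]
        rw [this, map_zero]
      | cons x l ih =>
        have h1 : word deg W (x :: l) = gen deg W x.1 x.2 * word deg W l := by simp [word]
        have hg := gen_mem deg W x.1 x.2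
        have hl := word_mem deg W l
        rw [h1, deriv_mul deg W δ hδ hg hl, map_add, map_smul,
          deriv_mul deg W δ hδ (deriv_mem deg W δ hδ hg) hl,
          deriv_mul deg W δ hδ hg (deriv_mem deg W δ hδ hl), ih, deriv_gen, h0]
        rw [pow_succ]
        simp only [zero_mul, smul_zero, mul_zero, zero_add, add_zero]
        module
    | zero => simp
    | add x y _ _ h1 h2 => rw [map_add, map_add, h1, h2, add_zero]
    | smul c x _ h => rw [map_smul, map_smul, h, smul_zero]
  induction x using DirectSum.Decomposition.inductionOn (gr deg W) with
  | zero => simp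
  | homogeneous x => exact key _ x.1 x.2
  | add x y h1 h2 => rw [map_add, map_add, h1, h2, add_zero]

end deriv

end FreeCGA

/-- A (graded-)commutative differential graded algebra over `ℚ`, in non-negative cohomological
degrees. -/
structure CDGA : Type (u + 1) where
  carrier : Type u
  [ring : Ring carrier]
  [algebra : Algebra ℚ carrier]
  /-- the homogeneous part of degree `n` -/
  gr : ℕ → Submodule ℚ carrier
  [graded : GradedAlgebra gr]
  /-- the differential -/
  d : carrier →ₗ[ℚ] carrier
  d_mem : ∀ {n : ℕ} {x : carrier}, x ∈ gr n → d x ∈ gr (n + 1)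
  d_d : ∀ x, d (d x) = 0
  leibniz : ∀ {m n : ℕ} {x y : carrier}, x ∈ gr m → y ∈ gr n →
    d (x * y) = d x * y + (-1 : ℚ) ^ m • (x * d y)
  gr_comm : ∀ {m n : ℕ} {x y : carrier}, x ∈ gr m → y ∈ gr n →
    x * y = (-1 : ℚ) ^ (m * n) • (y * x)

namespace CDGA

attribute [instance] ring algebra graded

instance : CoeSort CDGA.{u} (Type u) := ⟨carrier⟩

/-- Morphisms of CDGAs: algebra maps of degree `0` which commute with the differentials. -/
@[ext]
structure Hom (A B : CDGA.{u}) : Type u where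
  toAlgHom : A →ₐ[ℚ] B
  map_gr : ∀ {n : ℕ} {x : A}, x ∈ A.gr n → toAlgHom x ∈ B.gr n
  map_d : ∀ x : A, toAlgHom (A.d x) = B.d (toAlgHom x)

instance : Category CDGA.{u} where
  Hom := Hom
  id A := ⟨AlgHom.id ℚ A, fun h => h, fun _ => rfl⟩
  comp f g := ⟨g.toAlgHom.comp f.toAlgHom, fun h => g.map_gr (f.map_gr h), fun x => by
    simp [f.map_d, g.map_d]⟩

theorem id_apply (A : CDGA.{u}) (x : A) : (𝟙 A : A ⟶ A).toAlgHom x = x := rfl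

theorem comp_apply {A B C : CDGA.{u}} (f : A ⟶ B) (g : B ⟶ C) (x : A) :
    (f ≫ g).toAlgHom x = g.toAlgHom (f.toAlgHom x) := rfl

theorem hom_ext {A B : CDGA.{u}} {f g : A ⟶ B} (h : ∀ x : A, f.toAlgHom x = g.toAlgHom x) :
    f = g :=
  Hom.ext (AlgHom.ext h)

/-! ### Cohomology -/

/-- The cocycles of degree `n`. -/
def Z (A : CDGA.{u}) (n : ℕ) : Submodule ℚ A := A.gr n ⊓ LinearMap.ker A.d

/-- The coboundaries of degree `n`. -/
def B (A : CDGA.{u}) (n : ℕ) : Submodule ℚ A := A.gr n ⊓ LinearMap.range A.d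

/-- The `n`-th cohomology. -/
abbrev H (A : CDGA.{u}) (n : ℕ) : Type u := A.Z n ⧸ (A.B n).comap (A.Z n).subtype

/-- The cohomology class of a cocycle. -/
def cls (A : CDGA.{u}) {n : ℕ} : A.Z n →ₗ[ℚ] A.H n := Submodule.mkQ _

theorem one_mem_Z (A : CDGA.{u}) : (1 : A) ∈ A.Z 0 := by
  have h1 : (1 : A) ∈ A.gr 0 := SetLike.GradedOne.one_mem
  refine ⟨h1, ?_⟩
  have := A.leibniz h1 h1
  simpa using this

theorem mul_mem_Z (A : CDGA.{u}) {m n : ℕ} {x y : A} (hx : x ∈ A.Z m) (hy : y ∈ A.Z n) :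
    x * y ∈ A.Z (m + n) := by
  refine ⟨SetLike.mul_mem_graded hx.1 hy.1, ?_⟩
  have h1 : A.d x = 0 := hx.2
  have h2 : A.d y = 0 := hy.2
  simp [A.leibniz hx.1 hy.1, h1, h2]

/-- A morphism restricted to the cocycles. -/
def Hom.mapZ {A B : CDGA.{u}} (f : A ⟶ B) (n : ℕ) : A.Z n →ₗ[ℚ] B.Z n :=
  (f.toAlgHom.toLinearMap.domRestrict (A.Z n)).codRestrict (B.Z n) fun x =>
    ⟨f.map_gr x.2.1, by
      have h : A.d x = 0 := x.2.2
      have := f.map_d x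
      rw [h, map_zero] at this
      exact this.symm⟩

/-- The map induced in cohomology. -/
def Hom.mapH {A B : CDGA.{u}} (f : A ⟶ B) (n : ℕ) : A.H n →ₗ[ℚ] B.H n :=
  Submodule.mapQ _ _ (Hom.mapZ f n) (by
    rintro ⟨x, hx⟩ ⟨h1, y, hy⟩
    exact ⟨f.map_gr h1, f.toAlgHom y, by rw [← f.map_d, hy]; rfl⟩)

/-- Quasi-isomorphisms (weak equivalences) of CDGAs. -/
def IsQuasiIso {A B : CDGA.{u}} (f : A ⟶ B) : Prop :=
  ∀ n, Function.Bijective (Hom.mapH f n)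

/-- `A` and `B` have the same rational homotopy type: they are connected by a finite zig-zag of
quasi-isomorphisms of CDGAs. -/
def SameRationalHomotopyType (A B : CDGA.{u}) : Prop :=
  Relation.EqvGen (fun A B : CDGA.{u} => ∃ f : A ⟶ B, IsQuasiIso f) A B

/-- `A` and `B` have isomorphic cohomology algebras: there are linear isomorphisms in every degree
that respect the unit and the products `[x] [y] = [x y]`. -/
def SameCohomology (A B : CDGA.{u}) : Prop :=
  ∃ e : ∀ n, A.H n ≃ₗ[ℚ] B.H n,
    e 0 (A.cls ⟨1, A.one_mem_Z⟩) = B.cls ⟨1, B.one_mem_Z⟩ ∧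
    ∀ (m n : ℕ) (x : A.Z m) (y : A.Z n) (x' : B.Z m) (y' : B.Z n),
      e m (A.cls x) = B.cls x' → e n (A.cls y) = B.cls y' →
        e (m + n) (A.cls ⟨x * y, A.mul_mem_Z x.2 y.2⟩)
          = B.cls ⟨x' * y', B.mul_mem_Z x'.2 y'.2⟩

/-! ### Minimal algebras -/

/-- The algebra map from the free graded-commutative algebra on subspaces `V n` of the homogeneous
parts of `A` to `A`. -/
noncomputable def ofFree (A : CDGA.{u}) (V : ℕ → Submodule ℚ A) (hV : ∀ n, V n ≤ A.gr n) :
    FreeCGA (fun n : ℕ => n) (fun n => V n) →ₐ[ℚ] A :=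
  FreeCGA.lift (deg := fun n : ℕ => n) (fun n => (V n).subtype)
    (fun i j v w => A.gr_comm (hV i v.2) (hV j w.2))

/-- Minimal algebras: `A` is free as a graded-commutative algebra on graded generators `V n`,
`n ≥ 2`, and the differential of a generator of degree `n` lies in the subalgebra generated by the
generators of degree `< n`. Equivalently, the subalgebras `A_n` generated by the `V k`, `k ≤ n`,
form an increasing filtration with union `A`, with `A_0 = A_1 = ℚ`, and every `A_(n-1) ⊆ A_n` is a
Hirsch extension (by generators of degree `n`). -/
def IsMinimal (A : CDGA.{u}) : Prop :=
  ∃ (V : ℕ → Submodule ℚ A) (hV : ∀ n, V n ≤ A.gr n), V 0 = ⊥ ∧ V 1 = ⊥ ∧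
    Function.Bijective (A.ofFree V hV) ∧
    ∀ n, ∀ v ∈ V n, A.d v ∈ Algebra.adjoin ℚ (⋃ k ∈ Set.Iio n, (V k : Set A))

/-! ### The acyclic algebra on a graded vector space -/

section acyclic

variable (V : ℕ → Type u) [∀ n, AddCommGroup (V n)] [∀ n, Module ℚ (V n)]

/-- The degrees of the generators of `Λ(V ⊕ sV)`: the index `(n, false)` stands for `V n` in degree
`n`, and `(n, true)` for its suspension in degree `n + 1`. -/
def acDeg (i : ℕ × Bool) : ℕ := if i.2 then i.1 + 1 else i.1

/-- The differential on the generators of `Λ(V ⊕ sV)`. -/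
noncomputable def acδ : ∀ i : ℕ × Bool, V i.1 →ₗ[ℚ] FreeCGA acDeg (fun i : ℕ × Bool => V i.1)
  | (n, false) => FreeCGA.gen acDeg (fun i : ℕ × Bool => V i.1) (n, true)
  | (_, true) => 0

theorem acδ_mem (i : ℕ × Bool) (v : V i.1) :
    acδ V i v ∈ FreeCGA.gr acDeg (fun i : ℕ × Bool => V i.1) (acDeg i + 1) := by
  obtain ⟨n, _ | _⟩ := i
  · exact FreeCGA.gen_mem acDeg (fun i : ℕ × Bool => V i.1) (n, true) v
  · exact Submodule.zero_mem _

/-- The free CDGA `Λ(V ⊕ sV)` with `d v = s v`, for a graded vector space `V`. -/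
noncomputable def acyclic : CDGA.{u} where
  carrier := FreeCGA acDeg (fun i : ℕ × Bool => V i.1)
  gr := FreeCGA.gr acDeg (fun i : ℕ × Bool => V i.1)
  d := FreeCGA.deriv acDeg (fun i : ℕ × Bool => V i.1) (acδ V) (acδ_mem V)
  d_mem := FreeCGA.deriv_mem _ _ _ _
  d_d := FreeCGA.deriv_deriv _ _ _ _ (by
    rintro ⟨n, _ | _⟩ v
    · exact FreeCGA.deriv_gen acDeg (fun i : ℕ × Bool => V i.1) (acδ V) (acδ_mem V) (n, true) v
    · simp [acδ])
  leibniz := FreeCGA.deriv_mul _ _ _ _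
  gr_comm := FreeCGA.gr_comm _ _

/-- The generators of `Λ(V ⊕ sV)` which come from `V`. -/
noncomputable def acGen (n : ℕ) : V n →ₗ[ℚ] acyclic V :=
  FreeCGA.gen acDeg (fun i : ℕ × Bool => V i.1) (n, false)

theorem acGen_mem (n : ℕ) (v : V n) : acGen V n v ∈ (acyclic V).gr n :=
  FreeCGA.gen_mem acDeg (fun i : ℕ × Bool => V i.1) (n, false) v

theorem d_acGen (n : ℕ) (v : V n) : (acyclic V).d (acGen V n v)
    = FreeCGA.gen acDeg (fun i : ℕ × Bool => V i.1) (n, true) v :=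
  FreeCGA.deriv_gen acDeg (fun i : ℕ × Bool => V i.1) (acδ V) (acδ_mem V) (n, false) v

variable {V} {C : CDGA.{u}}

/-- Values on the generators of a morphism out of `Λ(V ⊕ sV)`. -/
noncomputable def acLiftGen (g : ∀ n, V n →ₗ[ℚ] C) : ∀ i : ℕ × Bool, V i.1 →ₗ[ℚ] C
  | (n, false) => g n
  | (n, true) => C.d ∘ₗ g n

theorem acLiftGen_mem (g : ∀ n, V n →ₗ[ℚ] C) (hg : ∀ n v, g n v ∈ C.gr n) (i : ℕ × Bool)
    (v : V i.1) : acLiftGen g i v ∈ C.gr (acDeg i) := by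
  obtain ⟨n, _ | _⟩ := i
  · exact hg n v
  · exact C.d_mem (hg n v)

/-- The algebra map underlying `acLift`. -/
noncomputable def acLiftHom (g : ∀ n, V n →ₗ[ℚ] C) (hg : ∀ n v, g n v ∈ C.gr n) :
    acyclic V →ₐ[ℚ] C :=
  FreeCGA.lift (deg := acDeg) (W := fun i : ℕ × Bool => V i.1) (acLiftGen g)
    (fun i j v w => C.gr_comm (acLiftGen_mem g hg i v) (acLiftGen_mem g hg j w))

theorem acLiftHom_gen (g : ∀ n, V n →ₗ[ℚ] C) (hg : ∀ n v, g n v ∈ C.gr n) (i : ℕ × Bool)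
    (v : V i.1) : acLiftHom g hg (FreeCGA.gen acDeg (fun i : ℕ × Bool => V i.1) i v)
      = acLiftGen g i v :=
  FreeCGA.lift_gen (deg := acDeg) (W := fun i : ℕ × Bool => V i.1) (acLiftGen g)
    (fun i j v w => C.gr_comm (acLiftGen_mem g hg i v) (acLiftGen_mem g hg j w)) i v

theorem acLiftHom_mem (g : ∀ n, V n →ₗ[ℚ] C) (hg : ∀ n v, g n v ∈ C.gr n) {n : ℕ}
    {x : acyclic V} (hx : x ∈ (acyclic V).gr n) : acLiftHom g hg x ∈ C.gr n := by
  induction hx using Submodule.span_induction with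
  | mem x h =>
    obtain ⟨l, rfl, rfl⟩ := h
    induction l with
    | nil =>
      have : (1 : C) ∈ C.gr 0 := SetLike.GradedOne.one_mem
      exact (map_one (acLiftHom g hg)).symm ▸ this
    | cons x l ih =>
      have h1 : FreeCGA.word acDeg (fun i : ℕ × Bool => V i.1) (x :: l)
        = FreeCGA.gen acDeg (fun i : ℕ × Bool => V i.1) x.1 x.2 *
          FreeCGA.word acDeg (fun i : ℕ × Bool => V i.1) l := by simp [FreeCGA.word]
      have h2 : FreeCGA.wdeg acDeg (fun i : ℕ × Bool => V i.1) (x :: l)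
        = acDeg x.1 + FreeCGA.wdeg acDeg (fun i : ℕ × Bool => V i.1) l := by
          simp [FreeCGA.wdeg]
      rw [h2]
      have h3 := SetLike.mul_mem_graded (A := C.gr) (acLiftGen_mem g hg x.1 x.2) ih
      rw [← acLiftHom_gen g hg] at h3
      rw [h1]
      refine Eq.subst (motive := fun z => z ∈ C.gr _) ?_ h3
      exact (map_mul (acLiftHom g hg) _ _).symm
  | zero => exact (map_zero (acLiftHom g hg)) ▸ Submodule.zero_mem _
  | add x y _ _ h1 h2 => exact (map_add (acLiftHom g hg) x y) ▸ add_mem h1 h2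
  | smul c x _ h => exact (map_smul (acLiftHom g hg) c x) ▸ Submodule.smul_mem _ c h

theorem map_d_mul {D : CDGA.{u}} (f : D →ₐ[ℚ] C)
    (hf : ∀ {n : ℕ} {x : D}, x ∈ D.gr n → f x ∈ C.gr n) {m n : ℕ} {a b : D} (ha : a ∈ D.gr m)
    (hb : b ∈ D.gr n) (h1 : f (D.d a) = C.d (f a)) (h2 : f (D.d b) = C.d (f b)) :
    f (D.d (a * b)) = C.d (f (a * b)) := by
  rw [D.leibniz ha hb, map_add, map_smul, map_mul, map_mul, map_mul, h1, h2,
    C.leibniz (hf ha) (hf hb)]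

theorem map_d_add {D : CDGA.{u}} (f : D →ₐ[ℚ] C) {a b : D}
    (h1 : f (D.d a) = C.d (f a)) (h2 : f (D.d b) = C.d (f b)) :
    f (D.d (a + b)) = C.d (f (a + b)) := by
  rw [map_add, map_add, map_add, map_add, h1, h2]

theorem acLiftHom_d (g : ∀ n, V n →ₗ[ℚ] C) (hg : ∀ n v, g n v ∈ C.gr n) (x : acyclic V) :
    acLiftHom g hg ((acyclic V).d x) = C.d (acLiftHom g hg x) := by
  have one_d : ∀ A : CDGA.{u}, A.d 1 = 0 := fun A => A.one_mem_Z.2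
  have key : ∀ n, ∀ x ∈ (acyclic V).gr n,
      acLiftHom g hg ((acyclic V).d x) = C.d (acLiftHom g hg x) := by
    intro n x hx
    induction hx using Submodule.span_induction with
    | mem x h =>
      obtain ⟨l, rfl, rfl⟩ := h
      induction l with
      | nil =>
        change acLiftHom g hg ((acyclic V).d 1) = C.d (acLiftHom g hg 1)
        rw [one_d, map_zero, map_one, one_d]
      | cons x l ih =>
        have h1 : FreeCGA.word acDeg (fun i : ℕ × Bool => V i.1) (x :: l)
          = FreeCGA.gen acDeg (fun i : ℕ × Bool => V i.1) x.1 x.2 *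
            FreeCGA.word acDeg (fun i : ℕ × Bool => V i.1) l := by simp [FreeCGA.word]
        have h0 : acLiftHom g hg ((acyclic V).d (FreeCGA.gen acDeg _ x.1 x.2))
            = C.d (acLiftHom g hg (FreeCGA.gen acDeg (fun i : ℕ × Bool => V i.1) x.1 x.2)) := by
          obtain ⟨⟨n, _ | _⟩, v⟩ := x
          · refine (congrArg (acLiftHom g hg) (d_acGen V n v)).trans ?_
            rw [acLiftHom_gen, acLiftHom_gen]
            rfl
          · rw [acLiftHom_gen]
            refine (congrArg (acLiftHom g hg) (FreeCGA.deriv_gen acDeg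
              (fun i : ℕ × Bool => V i.1) (acδ V) (acδ_mem V) (n, true) v)).trans ?_
            exact (map_zero (acLiftHom g hg)).trans (C.d_d _).symm
        have hg' : FreeCGA.gen acDeg (fun i : ℕ × Bool => V i.1) x.1 x.2
            ∈ (acyclic V).gr (acDeg x.1) := FreeCGA.gen_mem acDeg (fun i : ℕ × Bool => V i.1) x.1 x.2
        have hl : FreeCGA.word acDeg (fun i : ℕ × Bool => V i.1) l
            ∈ (acyclic V).gr (FreeCGA.wdeg acDeg _ l) := FreeCGA.word_mem acDeg (fun i : ℕ × Bool => V i.1) l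
        rw [h1]
        exact map_d_mul (acLiftHom g hg) (acLiftHom_mem g hg) hg' hl h0 ih
    | zero =>
      change acLiftHom g hg ((acyclic V).d (0 : acyclic V)) = C.d (acLiftHom g hg (0 : acyclic V))
      rw [map_zero, map_zero, map_zero]
    | add x y _ _ h1 h2 =>
      change acLiftHom g hg ((acyclic V).d ((x : acyclic V) + (y : acyclic V)))
          = C.d (acLiftHom g hg ((x : acyclic V) + (y : acyclic V)))
      rw [map_add, map_add, map_add, map_add, h1, h2]
    | smul c x _ h =>
      change acLiftHom g hg ((acyclic V).d (c • (x : acyclic V)))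
          = C.d (acLiftHom g hg (c • (x : acyclic V)))
      rw [map_smul, map_smul, map_smul, map_smul, h]
  induction x using DirectSum.Decomposition.inductionOn (acyclic V).gr with
  | zero => simp only [map_zero]
  | homogeneous x => exact key _ x.1 x.2
  | add x y h1 h2 => rw [map_add, map_add, map_add, map_add, h1, h2]

/-- The universal property of `Λ(V ⊕ sV)`: a morphism to `C` is given by a degree-preserving linear
map `V → C`. -/
noncomputable def acLift (g : ∀ n, V n →ₗ[ℚ] C) (hg : ∀ n v, g n v ∈ C.gr n) : acyclic V ⟶ C where
  toAlgHom := acLiftHom g hg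
  map_gr := acLiftHom_mem g hg
  map_d := acLiftHom_d g hg

theorem acLift_gen (g : ∀ n, V n →ₗ[ℚ] C) (hg : ∀ n v, g n v ∈ C.gr n) (n : ℕ) (v : V n) :
    (acLift g hg).toAlgHom (acGen V n v) = g n v :=
  acLiftHom_gen g hg (n, false) v

theorem acyclic_hom_ext {f g : acyclic V ⟶ C}
    (h : ∀ n v, f.toAlgHom (acGen V n v) = g.toAlgHom (acGen V n v)) : f = g := by
  apply Hom.ext
  apply FreeCGA.algHom_ext (deg := acDeg) (W := fun i : ℕ × Bool => V i.1)
  rintro ⟨n, _ | _⟩ v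
  · exact h n v
  · have h1 := congrArg C.d (h n v)
    rw [← f.map_d, ← g.map_d, d_acGen] at h1
    exact h1

end acyclic
end CDGA

namespace CDGA

/-! ### The tensor product -/

section tensor

variable (A B : CDGA.{u})

/-- The underlying algebra of the tensor product: Mathlib's graded tensor product, with
multiplication `(a ⊗ b) (a' ⊗ b') = (-1) ^ (|b| |a'|) • aa' ⊗ bb'`. -/
abbrev T : Type u := A.gr ᵍ⊗[ℚ] B.gr

variable {A B}

theorem sign_eq {a b k : ℕ} (h : a = b + 2 * k) : (-1 : ℚ) ^ a = (-1) ^ b := by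
  rw [h, pow_add, pow_mul]
  simp

theorem sign_units (k : ℕ) : ((-1 : ℤˣ) ^ k : ℤˣ) = 1 ∧ (-1 : ℚ) ^ k = 1 ∨
    ((-1 : ℤˣ) ^ k : ℤˣ) = -1 ∧ (-1 : ℚ) ^ k = -1 := by
  have e := uzpow_natCast (R := ℕ) (-1 : ℤˣ) k
  rw [Nat.cast_id] at e
  rw [e]
  rcases Nat.even_or_odd k with h1 | h1
  · exact Or.inl ⟨h1.neg_one_pow, h1.neg_one_pow⟩
  · exact Or.inr ⟨h1.neg_one_pow, h1.neg_one_pow⟩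

theorem tmul_mul {i j : ℕ} (a : A) {b : B} (hb : b ∈ B.gr j) {a' : A} (ha' : a' ∈ A.gr i) (b' : B) :
    (a ᵍ⊗ₜ[ℚ] b * a' ᵍ⊗ₜ[ℚ] b' : T A B) = (-1 : ℚ) ^ (j * i) • ((a * a') ᵍ⊗ₜ[ℚ] (b * b')) := by
  have h := GradedTensorProduct.tmul_coe_mul_coe_tmul A.gr B.gr a ⟨b, hb⟩ ⟨a', ha'⟩ b' (R := ℚ)
  refine h.trans ?_
  rcases sign_units (j * i) with ⟨h1, h2⟩ | ⟨h1, h2⟩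
  · rw [h1, h2, one_smul, one_smul]
  · rw [h1, h2, Units.neg_smul, one_smul, neg_smul, one_smul]

variable (A B)

/-- The degree `n` part is spanned by the `a ⊗ b` with `|a| + |b| = n`. -/
noncomputable def tgr (n : ℕ) : Submodule ℚ (T A B) :=
  Submodule.span ℚ {t | ∃ i j, i + j = n ∧ ∃ a ∈ A.gr i, ∃ b ∈ B.gr j, a ᵍ⊗ₜ[ℚ] b = t}

variable {A B}

theorem tmul_mem {i j n : ℕ} {a : A} {b : B} (ha : a ∈ A.gr i) (hb : b ∈ B.gr j) (h : i + j = n) :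
    (a ᵍ⊗ₜ[ℚ] b : T A B) ∈ tgr A B n :=
  Submodule.subset_span ⟨i, j, h, a, ha, b, hb, rfl⟩

theorem tensor_induction {p : T A B → Prop} (x : T A B) (h0 : p 0)
    (h1 : ∀ i j, ∀ a ∈ A.gr i, ∀ b ∈ B.gr j, p (a ᵍ⊗ₜ[ℚ] b)) (h2 : ∀ x y, p x → p y → p (x + y)) :
    p x := by
  have key : ∀ (a : A) (b : B), p (a ᵍ⊗ₜ[ℚ] b) := by
    intro a b
    induction a using DirectSum.Decomposition.inductionOn A.gr with
    | zero => rw [GradedTensorProduct.tmul, TensorProduct.zero_tmul, map_zero]; exact h0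
    | homogeneous a =>
      induction b using DirectSum.Decomposition.inductionOn B.gr with
      | zero => rw [GradedTensorProduct.tmul, TensorProduct.tmul_zero, map_zero]; exact h0
      | homogeneous b => exact h1 _ _ _ a.2 _ b.2
      | add b b' hb hb' =>
        rw [GradedTensorProduct.tmul, TensorProduct.tmul_add, map_add]
        exact h2 _ _ hb hb'
    | add a a' ha ha' =>
      rw [GradedTensorProduct.tmul, TensorProduct.add_tmul, map_add]
      exact h2 _ _ ha ha'
  induction (x : A.carrier ⊗[ℚ] B.carrier) using TensorProduct.induction_on with
  | zero => exact h0
  | tmul a b => exact key a b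
  | add x y hx hy => exact h2 _ _ hx hy

instance tgr_gradedMonoid : SetLike.GradedMonoid (tgr A B) where
  one_mem := tmul_mem (i := 0) (j := 0) SetLike.GradedOne.one_mem SetLike.GradedOne.one_mem rfl
  mul_mem := by
    intro m n x y hx hy
    induction hx, hy using Submodule.span_induction₂ with
    | mem_mem x y hx hy =>
      obtain ⟨i, j, rfl, a, ha, b, hb, rfl⟩ := hx
      obtain ⟨i', j', rfl, a', ha', b', hb', rfl⟩ := hy
      rw [tmul_mul a hb ha' b']
      exact Submodule.smul_mem _ _ (tmul_mem (SetLike.mul_mem_graded ha ha')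
        (SetLike.mul_mem_graded hb hb') (by ring))
    | zero_left y hy => simp
    | zero_right y hy => simp
    | add_left x y z _ _ _ h1 h2 => rw [add_mul]; exact add_mem h1 h2
    | add_right x y z _ _ _ h1 h2 => rw [mul_add]; exact add_mem h1 h2
    | smul_left r x y _ _ h => rw [smul_mul_assoc]; exact Submodule.smul_mem _ _ h
    | smul_right r x y _ _ h => rw [mul_smul_comm]; exact Submodule.smul_mem _ _ h

variable (A B)

/-- The product of homogeneous parts. -/
noncomputable def tpair (i j : ℕ) : A.gr i ⊗[ℚ] B.gr j →ₗ[ℚ] tgr A B (i + j) :=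
  LinearMap.codRestrict (tgr A B (i + j))
    ((GradedTensorProduct.of ℚ A.gr B.gr).toLinearMap ∘ₗ
      TensorProduct.map (A.gr i).subtype (B.gr j).subtype) (by
    intro x
    induction x using TensorProduct.induction_on with
    | zero => rw [map_zero]; exact Submodule.zero_mem _
    | tmul a b => exact tmul_mem a.2 b.2 rfl
    | add x y hx hy => rw [map_add]; exact add_mem hx hy)

/-- The decomposition into homogeneous parts. -/
noncomputable def tdecomp : T A B →ₗ[ℚ] DirectSum ℕ (fun n => tgr A B n) :=
  DirectSum.toModule ℚ (ℕ × ℕ) _ (fun ij =>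
      DirectSum.lof ℚ ℕ (fun n => tgr A B n) (ij.1 + ij.2) ∘ₗ tpair A B ij.1 ij.2) ∘ₗ
    (TensorProduct.directSum ℚ ℚ (fun i => A.gr i) (fun j => B.gr j)).toLinearMap ∘ₗ
    (GradedTensorProduct.auxEquiv ℚ A.gr B.gr).toLinearMap

variable {A B}

theorem tdecomp_tmul {i j n : ℕ} {a : A} {b : B} (ha : a ∈ A.gr i) (hb : b ∈ B.gr j)
    (h : i + j = n) : tdecomp A B (a ᵍ⊗ₜ[ℚ] b) =
      DirectSum.lof ℚ ℕ (fun n => tgr A B n) n ⟨a ᵍ⊗ₜ[ℚ] b, tmul_mem ha hb h⟩ := by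
  subst h
  simp only [tdecomp, LinearMap.comp_apply, LinearEquiv.coe_coe, GradedTensorProduct.auxEquiv_tmul]
  rw [DirectSum.decompose_of_mem _ ha, DirectSum.decompose_of_mem _ hb, ← DirectSum.lof_eq_of ℚ,
    ← DirectSum.lof_eq_of ℚ, TensorProduct.directSum_lof_tmul_lof, DirectSum.toModule_lof]
  rfl

noncomputable instance tgr_gradedAlgebra : GradedAlgebra (tgr A B) where
  toDecomposition := DirectSum.Decomposition.ofLinearMap (tgr A B) (tdecomp A B)
    (by
      refine LinearMap.ext fun x => ?_
      change DirectSum.coeLinearMap (tgr A B) (tdecomp A B x) = x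
      induction x using tensor_induction with
      | h0 => simp
      | h1 i j a ha b hb => rw [tdecomp_tmul ha hb rfl, DirectSum.coeLinearMap_lof]
      | h2 x y hx hy => rw [map_add, map_add, hx, hy])
    (by
      ext n ⟨x, hx⟩ : 2
      rw [LinearMap.comp_apply, LinearMap.comp_apply, DirectSum.coeLinearMap_lof,
        LinearMap.comp_apply, LinearMap.id_apply]
      induction hx using Submodule.span_induction with
      | mem x h =>
        obtain ⟨i, j, h, a, ha, b, hb, rfl⟩ := h
        exact tdecomp_tmul ha hb h
      | zero =>
        rw [map_zero]
        exact (map_zero (DirectSum.lof ℚ ℕ (fun n => tgr A B n) n)).symm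
      | add x y hx hy h1 h2 =>
        simp only [map_add] at *
        rw [h1, h2, ← map_add]; rfl
      | smul c x hx h =>
        simp only [map_smul] at *
        rw [h, ← map_smul]; rfl)

/-- The sign involution `a ↦ (-1) ^ |a| • a`. -/
noncomputable def sgn (A : CDGA.{u}) : A →ₗ[ℚ] A :=
  DirectSum.toModule ℚ ℕ _ (fun n => (-1 : ℚ) ^ n • (A.gr n).subtype) ∘ₗ
    (DirectSum.decomposeLinearEquiv A.gr).toLinearMap

theorem sgn_apply {n : ℕ} {a : A} (ha : a ∈ A.gr n) : sgn A a = (-1 : ℚ) ^ n • a := by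
  simp only [sgn, LinearMap.comp_apply, LinearEquiv.coe_coe,
    DirectSum.decomposeLinearEquiv_apply]
  rw [DirectSum.decompose_of_mem _ ha, ← DirectSum.lof_eq_of ℚ, DirectSum.toModule_lof]
  rfl

variable (A B)

/-- The differential `d (a ⊗ b) = da ⊗ b + (-1) ^ |a| • a ⊗ db`. -/
noncomputable def td : T A B →ₗ[ℚ] T A B :=
  (GradedTensorProduct.of ℚ A.gr B.gr).toLinearMap ∘ₗ
    (TensorProduct.map A.d LinearMap.id + TensorProduct.map (sgn A) B.d) ∘ₗ
    (GradedTensorProduct.of ℚ A.gr B.gr).symm.toLinearMap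

variable {A B}

theorem td_tmul {i : ℕ} {a : A} (ha : a ∈ A.gr i) (b : B) :
    td A B (a ᵍ⊗ₜ[ℚ] b) = A.d a ᵍ⊗ₜ[ℚ] b + (-1 : ℚ) ^ i • (a ᵍ⊗ₜ[ℚ] B.d b) := by
  have : td A B (a ᵍ⊗ₜ[ℚ] b) = A.d a ᵍ⊗ₜ[ℚ] b + sgn A a ᵍ⊗ₜ[ℚ] B.d b := rfl
  rw [this, sgn_apply ha]
  rfl

theorem td_mem {n : ℕ} {x : T A B} (hx : x ∈ tgr A B n) : td A B x ∈ tgr A B (n + 1) := by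
  induction hx using Submodule.span_induction with
  | mem x h =>
    obtain ⟨i, j, rfl, a, ha, b, hb, rfl⟩ := h
    rw [td_tmul ha]
    exact add_mem (tmul_mem (A.d_mem ha) hb (by ring))
      (Submodule.smul_mem _ _ (tmul_mem ha (B.d_mem hb) (by ring)))
  | zero => rw [map_zero]; exact Submodule.zero_mem _
  | add x y _ _ h1 h2 => rw [map_add]; exact add_mem h1 h2
  | smul c x _ h => rw [map_smul]; exact Submodule.smul_mem _ _ h

theorem td_td (x : T A B) : td A B (td A B x) = 0 := by
  induction x using tensor_induction with
  | h0 => simp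
  | h1 i j a ha b hb =>
    rw [td_tmul ha, map_add, map_smul, td_tmul (A.d_mem ha), td_tmul ha, A.d_d, B.d_d, pow_succ]
    simp only [GradedTensorProduct.tmul, TensorProduct.zero_tmul, TensorProduct.tmul_zero, map_zero]
    module
  | h2 x y hx hy => rw [map_add, map_add, hx, hy, add_zero]

theorem t_leibniz {m n : ℕ} {x y : T A B} (hx : x ∈ tgr A B m) (hy : y ∈ tgr A B n) :
    td A B (x * y) = td A B x * y + (-1 : ℚ) ^ m • (x * td A B y) := by
  induction hx, hy using Submodule.span_induction₂ with
  | mem_mem x y hx hy =>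
    obtain ⟨i, j, rfl, a, ha, b, hb, rfl⟩ := hx
    obtain ⟨i', j', rfl, a', ha', b', hb', rfl⟩ := hy
    rw [tmul_mul a hb ha' b', map_smul, td_tmul (SetLike.mul_mem_graded ha ha'), td_tmul ha,
      td_tmul ha', add_mul, mul_add, smul_mul_assoc, mul_smul_comm, tmul_mul _ hb ha',
      tmul_mul _ (B.d_mem hb) ha', tmul_mul _ hb (A.d_mem ha'), tmul_mul _ hb ha',
      A.leibniz ha ha', B.leibniz hb hb']
    simp only [GradedTensorProduct.tmul, TensorProduct.add_tmul, TensorProduct.tmul_add, map_add,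
      ← TensorProduct.smul_tmul', TensorProduct.tmul_smul, map_smul, smul_add, smul_smul, ← pow_add]
    rw [sign_eq (show i + j + j * (i' + 1) = j * i' + i + 2 * j by ring),
      show i + (j + 1) * i' = j * i' + (i + i') by ring,
      show i + j + (i' + j * i') = j * i' + (i + i' + j) by ring]
    abel
  | zero_left y hy => simp
  | zero_right y hy => simp
  | add_left x y z _ _ _ h1 h2 => rw [add_mul, map_add, h1, h2, map_add, add_mul, add_mul]; module
  | add_right x y z _ _ _ h1 h2 => rw [mul_add, map_add, h1, h2, map_add, mul_add, mul_add]; module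
  | smul_left r x y _ _ h =>
    rw [smul_mul_assoc, map_smul, h, map_smul, smul_mul_assoc, smul_mul_assoc]; module
  | smul_right r x y _ _ h =>
    rw [mul_smul_comm, map_smul, h, map_smul, mul_smul_comm, mul_smul_comm]; module

theorem t_comm {m n : ℕ} {x y : T A B} (hx : x ∈ tgr A B m) (hy : y ∈ tgr A B n) :
    x * y = (-1 : ℚ) ^ (m * n) • (y * x) := by
  induction hx, hy using Submodule.span_induction₂ with
  | mem_mem x y hx hy =>
    obtain ⟨i, j, rfl, a, ha, b, hb, rfl⟩ := hx
    obtain ⟨i', j', rfl, a', ha', b', hb', rfl⟩ := hy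
    rw [tmul_mul a hb ha' b', tmul_mul a' hb' ha b, A.gr_comm ha ha', B.gr_comm hb hb']
    simp only [GradedTensorProduct.tmul, ← TensorProduct.smul_tmul', TensorProduct.tmul_smul,
      map_smul, smul_smul, ← pow_add]
    rw [sign_eq (show (i + j) * (i' + j') + j' * i = j * i' + (i * i' + j * j') + 2 * (j' * i) by
      ring)]
    congr 2
    ring
  | zero_left y hy => simp
  | zero_right y hy => simp
  | add_left x y z _ _ _ h1 h2 => rw [add_mul, h1, h2, mul_add, smul_add]
  | add_right x y z _ _ _ h1 h2 => rw [mul_add, h1, h2, add_mul, smul_add]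
  | smul_left r x y _ _ h => rw [smul_mul_assoc, h, mul_smul_comm, smul_comm]
  | smul_right r x y _ _ h => rw [mul_smul_comm, h, smul_mul_assoc, smul_comm]

variable (A B)

/-- The tensor product of CDGAs. -/
noncomputable def tensor : CDGA.{u} where
  carrier := T A B
  gr := tgr A B
  d := td A B
  d_mem := td_mem
  d_d := td_td
  leibniz := t_leibniz
  gr_comm := t_comm

/-- `a ↦ a ⊗ 1` -/
noncomputable def inl : A ⟶ tensor A B where
  toAlgHom := GradedTensorProduct.includeLeft A.gr B.gr
  map_gr h := tmul_mem h SetLike.GradedOne.one_mem rfl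
  map_d x := by
    have h1 : B.d 1 = 0 := B.one_mem_Z.2
    have h2 : td A B (x ᵍ⊗ₜ[ℚ] 1) = A.d x ᵍ⊗ₜ[ℚ] 1 + sgn A x ᵍ⊗ₜ[ℚ] B.d 1 := rfl
    rw [h1, GradedTensorProduct.tmul, GradedTensorProduct.tmul, GradedTensorProduct.tmul,
      TensorProduct.tmul_zero, map_zero, add_zero] at h2
    exact h2.symm

/-- `b ↦ 1 ⊗ b` -/
noncomputable def inr : B ⟶ tensor A B where
  toAlgHom := GradedTensorProduct.includeRight A.gr B.gr
  map_gr h := tmul_mem SetLike.GradedOne.one_mem h (zero_add _)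
  map_d x := by
    have h1 : A.d 1 = 0 := A.one_mem_Z.2
    have h2 := td_tmul (SetLike.GradedOne.one_mem : (1 : A) ∈ A.gr 0) x
    rw [h1, GradedTensorProduct.tmul, GradedTensorProduct.tmul, GradedTensorProduct.tmul,
      TensorProduct.zero_tmul, map_zero, zero_add, pow_zero, one_smul] at h2
    exact h2.symm

variable {A B} {C : CDGA.{u}}

theorem tmul_eq (a : A) (b : B) :
    (a ᵍ⊗ₜ[ℚ] b : T A B) = (inl A B).toAlgHom a * (inr A B).toAlgHom b :=
  (GradedTensorProduct.tmul_one_mul_one_tmul A.gr B.gr a b).symm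

/-- The algebra map underlying `tensorLift`. -/
noncomputable def tensorLiftHom (f : A ⟶ C) (g : B ⟶ C) : tensor A B →ₐ[ℚ] C :=
  GradedTensorProduct.lift A.gr B.gr f.toAlgHom g.toAlgHom (by
    intro i j a b
    rw [C.gr_comm (f.map_gr a.2) (g.map_gr b.2), mul_comm i j]
    rcases sign_units (j * i) with ⟨h1, h2⟩ | ⟨h1, h2⟩
    · rw [h1, h2, one_smul, one_smul]
    · rw [h1, h2, Units.neg_smul, one_smul, neg_smul, one_smul])

theorem tensorLiftHom_inl (f : A ⟶ C) (g : B ⟶ C) (a : A) :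
    tensorLiftHom f g ((inl A B).toAlgHom a) = f.toAlgHom a := by
  have h : tensorLiftHom f g ((inl A B).toAlgHom a) = f.toAlgHom a * g.toAlgHom 1 := rfl
  rw [h, map_one, mul_one]

theorem tensorLiftHom_inr (f : A ⟶ C) (g : B ⟶ C) (b : B) :
    tensorLiftHom f g ((inr A B).toAlgHom b) = g.toAlgHom b := by
  have h : tensorLiftHom f g ((inr A B).toAlgHom b) = f.toAlgHom 1 * g.toAlgHom b := rfl
  rw [h, map_one, one_mul]

theorem tensorLiftHom_mem (f : A ⟶ C) (g : B ⟶ C) {n : ℕ} {x : tensor A B}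
    (hx : x ∈ (tensor A B).gr n) : tensorLiftHom f g x ∈ C.gr n := by
  induction hx using Submodule.span_induction with
  | mem x h =>
    obtain ⟨i, j, rfl, a, ha, b, hb, rfl⟩ := h
    exact SetLike.mul_mem_graded (f.map_gr ha) (g.map_gr hb)
  | zero => exact (map_zero (tensorLiftHom f g)).symm ▸ Submodule.zero_mem _
  | add x y _ _ h1 h2 => exact (map_add (tensorLiftHom f g) x y).symm ▸ add_mem h1 h2
  | smul c x _ h => exact (map_smul (tensorLiftHom f g) c x).symm ▸ Submodule.smul_mem _ c h

/-- The tensor product is the coproduct of CDGAs. -/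
noncomputable def tensorLift (f : A ⟶ C) (g : B ⟶ C) : tensor A B ⟶ C where
  toAlgHom := tensorLiftHom f g
  map_gr := tensorLiftHom_mem f g
  map_d x := by
    refine tensor_induction (p := fun x : T A B => tensorLiftHom f g ((tensor A B).d x)
      = C.d (tensorLiftHom f g x)) x ?_ ?_ ?_
    · exact (congrArg (tensorLiftHom f g) (map_zero (tensor A B).d)).trans
        ((map_zero (tensorLiftHom f g)).trans ((map_zero C.d).symm.trans
          (congrArg C.d (map_zero (tensorLiftHom f g)).symm)))
    · intro i j a ha b hb
      rw [tmul_eq]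
      refine map_d_mul (D := tensor A B) (tensorLiftHom f g) (tensorLiftHom_mem f g)
        ((inl A B).map_gr ha) ((inr A B).map_gr hb) ?_ ?_
      · rw [← (inl A B).map_d, tensorLiftHom_inl, tensorLiftHom_inl, f.map_d]
      · rw [← (inr A B).map_d, tensorLiftHom_inr, tensorLiftHom_inr, g.map_d]
    · intro x y hx hy
      exact map_d_add (D := tensor A B) (tensorLiftHom f g) hx hy

theorem tensorLift_inl (f : A ⟶ C) (g : B ⟶ C) (a : A) :
    (tensorLift f g).toAlgHom ((inl A B).toAlgHom a) = f.toAlgHom a :=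
  tensorLiftHom_inl f g a

theorem tensorLift_inr (f : A ⟶ C) (g : B ⟶ C) (b : B) :
    (tensorLift f g).toAlgHom ((inr A B).toAlgHom b) = g.toAlgHom b :=
  tensorLiftHom_inr f g b

theorem tensor_hom_ext {f g : tensor A B ⟶ C} (h1 : inl A B ≫ f = inl A B ≫ g)
    (h2 : inr A B ≫ f = inr A B ≫ g) : f = g :=
  Hom.ext (GradedTensorProduct.algHom_ext A.gr B.gr (congrArg Hom.toAlgHom h1)
    (congrArg Hom.toAlgHom h2))

end tensor
end CDGA

/-! ### The orbit category and diagrams of CDGAs -/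

/-- The orbit category of `G`: its objects are the `G`-sets `G ⧸ H`, for the subgroups `H`, and its
morphisms are the `G`-equivariant maps. -/
@[ext]
structure OrbitCat (G : Type u) [Group G] : Type u where
  /-- the stabiliser `H` of the orbit `G ⧸ H` -/
  sub : Subgroup G

instance OrbitCat.category (G : Type u) [Group G] : Category.{u} (OrbitCat G) where
  Hom H K := (G ⧸ H.sub) →[G] (G ⧸ K.sub)
  id H := MulActionHom.id G
  comp f g := MulActionHom.comp g f

/-- For finite `G`, two orbits with morphisms in both directions are isomorphic. -/
theorem OrbitCat.iso_of_hom {G : Type u} [Group G] [Finite G] {H K : OrbitCat G} (f : H ⟶ K)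
    (g : K ⟶ H) : Nonempty (H ≅ K) := by
  have surj : ∀ {H K : OrbitCat G} (f : (G ⧸ H.sub) →[G] (G ⧸ K.sub)),
      Function.Surjective f := by
    intro H K f y
    obtain ⟨a, ha⟩ := MulAction.exists_smul_eq G (f ((1 : G) : G ⧸ H.sub)) y
    exact ⟨a • ((1 : G) : G ⧸ H.sub), by rw [map_smul, ha]⟩
  let f' : (G ⧸ H.sub) →[G] (G ⧸ K.sub) := f
  have hb : Function.Bijective f' :=
    (surj f').bijective_of_nat_card_le (Nat.card_le_card_of_surjective _ (surj g))
  let e := Equiv.ofBijective f' hb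
  refine ⟨⟨f, MulActionHom.inverse f' e.symm e.left_inv e.right_inv, ?_, ?_⟩⟩
  · exact MulActionHom.ext e.left_inv
  · exact MulActionHom.ext e.right_inv

/-- Diagrams of CDGAs: covariant functors from the orbit category. -/
abbrev DGADiagram (G : Type u) [Group G] : Type (u + 1) := OrbitCat G ⥤ CDGA.{u}

namespace DGADiagram

open CDGA

variable {G : Type u} [Group G]

/-- A map of diagrams of CDGAs which is a quasi-isomorphism at every level `G ⧸ H`. -/
def IsQuasiIso {U V : DGADiagram G} (f : U ⟶ V) : Prop :=
  ∀ K, CDGA.IsQuasiIso (f.app K)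

/-- The underlying rational vector space. -/
def forgetCDGA : CDGA.{u} ⥤ ModuleCat.{u} ℚ where
  obj A := ModuleCat.of ℚ A
  map f := ModuleCat.ofHom f.toAlgHom.toLinearMap

/-- A diagram is injective (a *system of DGAs*) if its underlying dual rational coefficient
system, i.e. functor from the orbit category to rational vector spaces, is injective. -/
def IsInjective (U : DGADiagram G) : Prop :=
  Injective (U ⋙ forgetCDGA)

/-- Weak equivalence of systems of DGAs: the equivalence relation generated by the
quasi-isomorphisms between systems of DGAs. -/
def WeaklyEquivalent (U V : DGADiagram G) : Prop :=
  Relation.EqvGen (fun U V : DGADiagram G =>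
    IsInjective U ∧ IsInjective V ∧ ∃ f : U ⟶ V, IsQuasiIso f) U V

/-- `K < H` up to conjugacy: `K` is a proper subgroup of a conjugate of `H`, that is, there is a
morphism `G ⧸ K ⟶ G ⧸ H`, but these orbits are not isomorphic. -/
def Below (K H : OrbitCat G) : Prop :=
  Nonempty (K ⟶ H) ∧ IsEmpty (K ≅ H)

section enlarge

variable (U : DGADiagram G) (H : OrbitCat G)

/-- The intersection of the kernels of all maps `U (G ⧸ H) ⟶ U (G ⧸ K)` induced by the projections
`G ⧸ H ⟶ G ⧸ K` with `H` a proper subgroup of `K`. Up to isomorphism of the target these are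
precisely the morphisms of the orbit category from `G ⧸ H` to an orbit not isomorphic to it. -/
def kerSub : Submodule ℚ (U.obj H) :=
  ⨅ (K : OrbitCat G) (_ : IsEmpty (H ≅ K)) (α : H ⟶ K),
    LinearMap.ker (U.map α).toAlgHom.toLinearMap

theorem map_kerSub {K : OrbitCat G} (hK : IsEmpty (H ≅ K)) (α : H ⟶ K) {x : U.obj H}
    (hx : x ∈ kerSub U H) : (U.map α).toAlgHom x = 0 := by
  simp only [kerSub, Submodule.mem_iInf] at hx
  exact hx K hK α

/-- The degree `n` part of the injective coefficient system
`G ⧸ K ↦ Hom_(N(H)/H) ((G ⧸ H) ^ K, V_H)` with `V_H = kerSub U H`. Here `(G ⧸ H) ^ K` is the set of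
morphisms `G ⧸ K ⟶ G ⧸ H` and `N(H)/H` is the group of endomorphisms of `G ⧸ H`. -/
def coind (K : OrbitCat G) (n : ℕ) : Submodule ℚ ((K ⟶ H) → U.obj H) where
  carrier := {f | (∀ φ, f φ ∈ (U.obj H).gr n ∧ f φ ∈ kerSub U H) ∧
    ∀ (φ : K ⟶ H) (w : H ⟶ H), f (φ ≫ w) = (U.map w).toAlgHom (f φ)}
  zero_mem' := ⟨fun _ => ⟨zero_mem _, zero_mem _⟩, fun _ _ => (map_zero _).symm⟩
  add_mem' := fun hf hg => ⟨fun φ => ⟨add_mem (hf.1 φ).1 (hg.1 φ).1,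
    add_mem (hf.1 φ).2 (hg.1 φ).2⟩, fun φ w => by
      simp only [Pi.add_apply, hf.2 φ w, hg.2 φ w, map_add]⟩
  smul_mem' := fun c f hf => ⟨fun φ => ⟨Submodule.smul_mem _ c (hf.1 φ).1,
    Submodule.smul_mem _ c (hf.1 φ).2⟩, fun φ w => by
      simp only [Pi.smul_apply, hf.2 φ w, map_smul]⟩

/-- The structure maps of the coefficient system `coind`. -/
def coindMap {K K' : OrbitCat G} (α : K ⟶ K') (n : ℕ) : coind U H K n →ₗ[ℚ] coind U H K' n where
  toFun f := ⟨fun φ => f.1 (α ≫ φ), fun φ => f.2.1 _, fun φ w => by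
    exact (congrArg f.1 (Category.assoc α φ w).symm).trans (f.2.2 (α ≫ φ) w)⟩
  map_add' _ _ := rfl
  map_smul' _ _ := rfl

/-- The part of `coind` on which the acyclic algebra of the enlargement is built: all of it at the
`G ⧸ K` with `K < H`, and `0` at the other orbits. -/
def newGen (K : OrbitCat G) (n : ℕ) : Submodule ℚ (coind U H K n) where
  carrier := {f | ¬ Below K H → f = 0}
  zero_mem' := fun _ => rfl
  add_mem' := fun hf hg h => by rw [hf h, hg h, add_zero]
  smul_mem' := fun c f hf h => by rw [hf h, smul_zero]

/-- The value of the enlargement at `G ⧸ K`: the tensor product of `U (G ⧸ K)` with the acyclic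
algebra `Λ(V ⊕ sV)`, where `V = Hom_(N(H)/H) ((G ⧸ H) ^ K, V_H)` if `K < H`, and `V = 0`
otherwise. -/
noncomputable def enlargeObj (K : OrbitCat G) : CDGA.{u} :=
  tensor (U.obj K) (acyclic fun n => newGen U H K n)

/-- The inclusion of `U (G ⧸ K)` in the enlargement. -/
noncomputable def oldIncl (K : OrbitCat G) : U.obj K ⟶ enlargeObj U H K :=
  inl (U.obj K) (acyclic fun n => newGen U H K n)

/-- The inclusion of the acyclic algebra in the enlargement. -/
noncomputable def newIncl (K : OrbitCat G) :
    (acyclic fun n => newGen U H K n) ⟶ enlargeObj U H K :=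
  inr (U.obj K) (acyclic fun n => newGen U H K n)

open Classical in
/-- If `G ⧸ K ≅ G ⧸ H`, the identification of `Hom_(N(H)/H) ((G ⧸ H) ^ K, V_H)` with a subspace of
`U (G ⧸ K)`; it does not depend on the choice of the isomorphism. Zero for the other `K`. -/
noncomputable def evalIso (K : OrbitCat G) (n : ℕ) : coind U H K n →ₗ[ℚ] U.obj K :=
  if h : Nonempty (K ≅ H) then
    (U.map h.some.inv).toAlgHom.toLinearMap ∘ₗ LinearMap.proj h.some.hom ∘ₗ
      (coind U H K n).subtype
  else 0

theorem evalIso_eq {K : OrbitCat G} (e : K ≅ H) {n : ℕ} (f : coind U H K n) :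
    evalIso U H K n f = (U.map e.inv).toAlgHom (f.1 e.hom) := by
  have h : Nonempty (K ≅ H) := ⟨e⟩
  rw [evalIso, dif_pos h]
  change (U.map h.some.inv).toAlgHom (f.1 h.some.hom) = _
  generalize h.some = e'
  have h1 : e.hom = e'.hom ≫ (e'.inv ≫ e.hom) := by simp
  rw [h1, f.2.2, ← CDGA.comp_apply, ← Functor.map_comp]
  simp

theorem evalIso_zero {K : OrbitCat G} (h : ¬ Nonempty (K ≅ H)) {n : ℕ} (f : coind U H K n) :
    evalIso U H K n f = 0 := by
  rw [evalIso, dif_neg h]; rfl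

theorem evalIso_mem (K : OrbitCat G) {n : ℕ} (f : coind U H K n) :
    evalIso U H K n f ∈ (U.obj K).gr n := by
  by_cases h : Nonempty (K ≅ H)
  · obtain ⟨e⟩ := h
    rw [evalIso_eq U H e]
    exact Hom.map_gr _ (f.2.1 _).1
  · rw [evalIso_zero U H h]
    exact zero_mem _

theorem map_evalIso {K K' : OrbitCat G} (α : K ⟶ K') (hK : ¬ Below K H) {n : ℕ} (f : coind U H K n) :
    (U.map α).toAlgHom (evalIso U H K n f) = evalIso U H K' n (coindMap U H α n f) := by
  by_cases h : Nonempty (K ≅ H)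
  · obtain ⟨e⟩ := h
    rw [evalIso_eq U H e]
    by_cases h' : Nonempty (K' ≅ H)
    · obtain ⟨e'⟩ := h'
      rw [evalIso_eq U H e']
      change _ = (U.map e'.inv).toAlgHom (f.1 (α ≫ e'.hom))
      have h1 : α ≫ e'.hom = e.hom ≫ (e.inv ≫ α ≫ e'.hom) := by simp
      rw [h1, f.2.2, ← CDGA.comp_apply, ← CDGA.comp_apply, ← Functor.map_comp,
        ← Functor.map_comp]
      simp
    · rw [evalIso_zero U H h', ← CDGA.comp_apply, ← Functor.map_comp]
      exact map_kerSub U H ⟨fun i => h' ⟨i.symm⟩⟩ _ (f.2.1 _).2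
  · rw [evalIso_zero U H h, map_zero, evalIso_zero U H]
    rintro ⟨e'⟩
    exact hK ⟨⟨α ≫ e'.hom⟩, ⟨fun i => h ⟨i⟩⟩⟩

open Classical in
/-- The map from the coefficient system `coind` to the enlargement: the inclusion of the new
generators at the `G ⧸ K` with `K < H`, the identification with a subspace of `U (G ⧸ K)` at the
orbits isomorphic to `G ⧸ H`, and zero elsewhere. -/
noncomputable def toEnlarge (K : OrbitCat G) (n : ℕ) : coind U H K n →ₗ[ℚ] enlargeObj U H K :=
  if h : Below K H then
    (newIncl U H K).toAlgHom.toLinearMap ∘ₗ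
      acGen (fun n => newGen U H K n) n ∘ₗ
      LinearMap.codRestrict (newGen U H K n) LinearMap.id (fun _ h' => absurd h h')
  else
    (oldIncl U H K).toAlgHom.toLinearMap ∘ₗ evalIso U H K n

theorem toEnlarge_newGen {K : OrbitCat G} {n : ℕ} (f : newGen U H K n) :
    toEnlarge U H K n f.1 = (newIncl U H K).toAlgHom
      (acGen (fun n => newGen U H K n) n f) := by
  by_cases h : Below K H
  · rw [toEnlarge, dif_pos h]; rfl
  · have h0 : f = 0 := Subtype.ext (f.2 h)
    rw [h0, map_zero, map_zero]
    exact map_zero _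

theorem toEnlarge_not_below {K : OrbitCat G} (h : ¬ Below K H) {n : ℕ} (f : coind U H K n) :
    toEnlarge U H K n f = (oldIncl U H K).toAlgHom
      (evalIso U H K n f) := by
  rw [toEnlarge, dif_neg h]; rfl

theorem toEnlarge_mem (K : OrbitCat G) {n : ℕ} (f : coind U H K n) :
    toEnlarge U H K n f ∈ (enlargeObj U H K).gr n := by
  by_cases h : Below K H
  · rw [toEnlarge_newGen U H ⟨f, fun h' => absurd h h'⟩]
    exact Hom.map_gr _ (acGen_mem _ n _)
  · rw [toEnlarge_not_below U H h]
    exact Hom.map_gr _ (evalIso_mem U H K f)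

/-- The structure maps of the enlargement. They extend the structure maps of `U` and of the
coefficient system `coind`. -/
noncomputable def enlargeMap {K K' : OrbitCat G} (α : K ⟶ K') :
    enlargeObj U H K ⟶ enlargeObj U H K' :=
  tensorLift (U.map α ≫ oldIncl U H K')
    (acLift (fun n => toEnlarge U H K' n ∘ₗ coindMap U H α n ∘ₗ (newGen U H K n).subtype)
      (fun _ _ => toEnlarge_mem U H K' _))

theorem enlargeMap_inl {K K' : OrbitCat G} (α : K ⟶ K') (x : U.obj K) :
    (enlargeMap U H α).toAlgHom ((oldIncl U H K).toAlgHom x)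
      = (oldIncl U H K').toAlgHom ((U.map α).toAlgHom x) :=
  tensorLift_inl _ _ x

theorem enlargeMap_toEnlarge [Finite G] {K K' : OrbitCat G} (α : K ⟶ K') {n : ℕ} (f : coind U H K n) :
    (enlargeMap U H α).toAlgHom (toEnlarge U H K n f)
      = toEnlarge U H K' n (coindMap U H α n f) := by
  by_cases h : Below K H
  · have h1 := toEnlarge_newGen U H ⟨f, fun h' => absurd h h'⟩
    rw [h1, enlargeMap]
    exact (tensorLift_inr _ _ _).trans (acLift_gen _ _ n _)
  · have h' : ¬ Below K' H := by
      rintro ⟨⟨φ⟩, h2⟩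
      by_cases h3 : Nonempty (K ≅ H)
      · obtain ⟨e⟩ := h3
        exact h2.false (OrbitCat.iso_of_hom φ (e.inv ≫ α)).some
      · exact h ⟨⟨α ≫ φ⟩, ⟨fun i => h3 ⟨i⟩⟩⟩
    rw [toEnlarge_not_below U H h, enlargeMap_inl, map_evalIso U H α h,
      toEnlarge_not_below U H h']

theorem enlarge_hom_ext {K : OrbitCat G} {C : CDGA.{u}} {f g : enlargeObj U H K ⟶ C}
    (h1 : ∀ x : U.obj K,
      f.toAlgHom ((oldIncl U H K).toAlgHom x)
        = g.toAlgHom ((oldIncl U H K).toAlgHom x))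
    (h2 : ∀ n (x : newGen U H K n),
      f.toAlgHom (toEnlarge U H K n x.1) = g.toAlgHom (toEnlarge U H K n x.1)) : f = g := by
  refine tensor_hom_ext (CDGA.hom_ext h1) (acyclic_hom_ext fun n x => ?_)
  have := h2 n x
  rw [toEnlarge_newGen] at this
  exact this

/-- The enlargement of the diagram `U` at `H`. -/
noncomputable def enlarge [Finite G] : DGADiagram G where
  obj := enlargeObj U H
  map := enlargeMap U H
  map_id K := by
    refine enlarge_hom_ext U H (fun x => ?_) (fun n x => ?_)
    · rw [enlargeMap_inl, U.map_id]; rfl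
    · rw [enlargeMap_toEnlarge]
      rfl
  map_comp α β := by
    refine enlarge_hom_ext U H (fun x => ?_) (fun n x => ?_)
    · rw [enlargeMap_inl, CDGA.comp_apply, enlargeMap_inl, enlargeMap_inl, U.map_comp,
        CDGA.comp_apply]
    · rw [enlargeMap_toEnlarge, CDGA.comp_apply, enlargeMap_toEnlarge, enlargeMap_toEnlarge]
      rfl

/-- The inclusion of `U` in its enlargement at `H`. -/
noncomputable def enlargeIncl [Finite G] : U ⟶ enlarge U H where
  app K := oldIncl U H K
  naturality _ _ α := CDGA.hom_ext fun x => (enlargeMap_inl U H α x).symm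

end enlarge

/-- An order in which the enlargements may be made: the list contains precisely one subgroup of
every conjugacy class, and the larger subgroups come first. -/
structure IsEnlargementOrder (L : List (OrbitCat G)) : Prop where
  complete : ∀ K : OrbitCat G, ∃ H ∈ L, Nonempty (H ≅ K)
  nonconj : L.Pairwise fun H K => IsEmpty (H ≅ K)
  sorted : L.Pairwise fun H K => ¬ Below H K

/-- The successive enlargements of a diagram at the subgroups in a list. For a list with
`IsEnlargementOrder` this is the *injective envelope* of the diagram. -/
noncomputable def envelope [Finite G] : List (OrbitCat G) → DGADiagram G → DGADiagram G
  | [], U => U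
  | H :: L, U => envelope L (enlarge U H)

/-- The inclusion of a diagram in its injective envelope. -/
noncomputable def envelopeIncl [Finite G] :
    (L : List (OrbitCat G)) → (U : DGADiagram G) → (U ⟶ envelope L U)
  | [], U => 𝟙 U
  | H :: L, U => enlargeIncl U H ≫ envelopeIncl L (enlarge U H)

end DGADiagram

/-! Everything rests on two properties of the envelope: its inclusion is a quasi-isomorphism at
every orbit, and the envelope is an injective diagram.

An enlargement tensors each value with some `Λ(V ⊕ sV)`, `d v = s v`. The derivation `s v ↦ v`, `v ↦
0` of degree `-1` has an anticommutator with `d` that multiplies a word by its length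
(`contract_homotopy`). Lengths of nonempty words are invertible in `ℚ`, so dividing by them gives a
homotopy from the identity to the augmentation. Tensoring it with an arbitrary `A` shows that `A → A
⊗ Λ(V ⊕ sV)` is a quasi-isomorphism (`isQuasiIso_inl`), and composing over the list gives
`isQuasiIso_envelopeIncl`. Part (1) follows: evaluate the zig-zag between the envelopes at an orbit
and join the two inclusions to its ends.

For (2), a map of diagrams preserves the intersections of kernels. It therefore acts on the new
generators, and the envelope is functorial compatibly with the inclusions (`exists_envelopeHom`).
The induced map is a quasi-isomorphism by two-out-of-three.

Weak equivalence also needs injectivity (`isInjective_envelope`). The enlargement at `H` makes every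
equivariant map into the intersection of kernels at `G/H` extend to a map of whole systems,
supported on the orbits that map to `G/H`: this is the universal property of coinduction. Later
enlargements do not change the value at `G/H` and keep this property. Given `f : X → F` and a
monomorphism `g : X → Y`, an extension is built orbit by orbit, larger subgroups first. Once the
error `f - g ≫ h` vanishes above `G/H`, its values at `G/H` lie in the intersection of kernels;
averaging over the automorphisms of `G/H` extends it equivariantly to `Y`, and the resulting
correction does not touch the orbits already treated. -/

namespace FreeCGA

variable {ι : Type} (deg : ι → ℕ) (W : ι → Type u) [∀ i, AddCommGroup (W i)]
  [∀ i, Module ℚ (W i)]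

/-! ### Words in the generators of a free graded-commutative algebra. -/

theorem word_cons (x : Σ i, W i) (l : List (Σ i, W i)) :
    word deg W (x :: l) = gen deg W x.1 x.2 * word deg W l := by simp [word]

theorem word_induction {p : FreeCGA deg W → Prop} (h0 : p 0)
    (hw : ∀ l, p (word deg W l)) (ha : ∀ x y, p x → p y → p (x + y))
    (hs : ∀ (c : ℚ) x, p x → p (c • x)) (x : FreeCGA deg W) : p x := by
  induction x using DirectSum.Decomposition.inductionOn (gr deg W) with
  | zero => exact h0
  | homogeneous x =>
    obtain ⟨x, hx⟩ := x
    induction hx using Submodule.span_induction with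
    | mem x h => obtain ⟨l, -, rfl⟩ := h; exact hw l
    | zero => exact h0
    | add x y _ _ h1 h2 => exact ha _ _ h1 h2
    | smul c x _ h => exact hs _ _ h
  | add x y h1 h2 => exact ha _ _ h1 h2

/-! ### Odd derivations -/

section odd

variable (δ : ∀ i, W i →ₗ[ℚ] FreeCGA deg W)

/-- Only the parity of a derivation enters the signs. A commutation rule as if `δ` raised degrees by
one therefore also covers derivations of degree `-1`, without subtraction in the grading by `ℕ`. -/
theorem derivGen_comm_of_odd
    (hδ : ∀ i j v w, gen deg W i v * δ j w
      = (-1 : ℚ) ^ (deg i * (deg j + 1)) • (δ j w * gen deg W i v))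
    (i j : ι) (v : W i) (w : W j) :
    derivGen deg W δ i v * derivGen deg W δ j w
      = (-1 : ℚ) ^ (deg i * deg j) • (derivGen deg W δ j w * derivGen deg W δ i v) := by
  have h1 := gen_comm deg W i j v w
  have h2 := hδ i j v w
  have h3 := hδ j i w v
  have e1 : ((-1 : ℚ) ^ deg i) * (-1) ^ (deg i * (deg j + 1)) = (-1) ^ (deg i * deg j) := by
    rw [← pow_add, show deg i + deg i * (deg j + 1) = deg i * deg j + 2 * deg i by ring, pow_add,
      pow_mul]
    simp
  have e2 : (-1 : ℚ) ^ (deg i * deg j) * ((-1) ^ deg j * (-1 : ℚ) ^ (deg j * (deg i + 1))) = 1 := by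
    rw [← pow_add, ← pow_add,
      show deg i * deg j + (deg j + deg j * (deg i + 1)) = 2 * (deg i * deg j + deg j) by ring,
      pow_mul]
    simp
  ext a b
  fin_cases a <;> fin_cases b
  · simp [derivGen, Matrix.mul_apply, Fin.sum_univ_two, h1, smul_smul]
    congr 1; ring
  · simp [derivGen, Matrix.mul_apply, Fin.sum_univ_two, h2, h3, smul_smul, e1, e2]
    abel
  · simp [derivGen, Matrix.mul_apply, Fin.sum_univ_two]
  · simpa [derivGen, Matrix.mul_apply, Fin.sum_univ_two] using h1

variable (hδ : ∀ i j v w, gen deg W i v * δ j w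
      = (-1 : ℚ) ^ (deg i * (deg j + 1)) • (δ j w * gen deg W i v))

/-- The algebra map `x ↦ (± x, h x; 0, x)` whose upper right entry is the odd derivation extending
`δ`. -/
noncomputable def oddDerivHom : FreeCGA deg W →ₐ[ℚ] Matrix (Fin 2) (Fin 2) (FreeCGA deg W) :=
  lift (deg := deg) (W := W) (derivGen deg W δ) (derivGen_comm_of_odd deg W δ hδ)

/-- The odd derivation which extends `δ`. -/
noncomputable def oddDeriv : FreeCGA deg W →ₗ[ℚ] FreeCGA deg W where
  toFun x := oddDerivHom deg W δ hδ x 0 1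
  map_add' x y := by rw [map_add]; rfl
  map_smul' c x := by rw [map_smul]; rfl

theorem oddDerivHom_gen (i : ι) (v : W i) :
    oddDerivHom deg W δ hδ (gen deg W i v) = derivGen deg W δ i v :=
  lift_gen (deg := deg) (W := W) (derivGen deg W δ) (derivGen_comm_of_odd deg W δ hδ) i v

theorem oddDeriv_one : oddDeriv deg W δ hδ 1 = 0 := by
  change oddDerivHom deg W δ hδ 1 0 1 = 0
  simp

theorem oddDerivHom_one_one (x : FreeCGA deg W) : oddDerivHom deg W δ hδ x 1 1 = x := by
  induction x using word_induction with
  | h0 => simp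
  | hw l =>
    induction l with
    | nil => simp [word]
    | cons x l ih =>
      rw [word_cons, map_mul, oddDerivHom_gen, Matrix.mul_apply, Fin.sum_univ_two, ih]
      simp [derivGen]
  | ha x y hx hy => rw [map_add, Matrix.add_apply, hx, hy]
  | hs c x hx => rw [map_smul, Matrix.smul_apply, hx]

/-- With a generator as left factor the sign depends on that generator alone, so the right factor
need not be homogeneous. -/
theorem oddDeriv_gen_mul (i : ι) (v : W i) (x : FreeCGA deg W) :
    oddDeriv deg W δ hδ (gen deg W i v * x)
      = δ i v * x + (-1 : ℚ) ^ deg i • (gen deg W i v * oddDeriv deg W δ hδ x) := by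
  change oddDerivHom deg W δ hδ (gen deg W i v * x) 0 1
    = δ i v * x + (-1 : ℚ) ^ deg i • (gen deg W i v * oddDerivHom deg W δ hδ x 0 1)
  rw [map_mul, Matrix.mul_apply, Fin.sum_univ_two, oddDerivHom_gen, oddDerivHom_one_one]
  simp [derivGen, add_comm]

end odd

/-! ### Word length -/

/-- The algebra map that multiplies every generator by a formal variable. -/
noncomputable def weight : FreeCGA deg W →ₐ[ℚ] Polynomial (FreeCGA deg W) :=
  lift (deg := deg) (W := W)
    (fun i => ((Polynomial.monomial (R := FreeCGA deg W) 1).restrictScalars ℚ) ∘ₗ gen deg W i)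
    (fun i j v w => by
      simp only [LinearMap.comp_apply, LinearMap.restrictScalars_apply,
        Polynomial.monomial_mul_monomial, Polynomial.smul_monomial]
      rw [gen_comm])

theorem weight_gen (i : ι) (v : W i) :
    weight deg W (gen deg W i v) = Polynomial.monomial 1 (gen deg W i v) :=
  lift_gen (deg := deg) (W := W) _ _ i v

theorem weight_word (l : List (Σ i, W i)) :
    weight deg W (word deg W l) = Polynomial.monomial l.length (word deg W l) := by
  induction l with
  | nil => simp [word]
  | cons x l ih =>
    rw [word_cons, map_mul, ih, weight_gen, Polynomial.monomial_mul_monomial, List.length_cons,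
      add_comm]

/-- Division by the word length. -/
noncomputable def divWeight : FreeCGA deg W →ₗ[ℚ] FreeCGA deg W :=
  (Polynomial.lsum (fun k : ℕ =>
    ((k : ℚ)⁻¹ • (LinearMap.id : FreeCGA deg W →ₗ[ℚ] FreeCGA deg W))))
    ∘ₗ (weight deg W).toLinearMap

/-- Phrased for elements of pure weight because it is applied to images of words under the
differential and the contraction, which are sums of words of one length. For `k = 0` the convention
`0⁻¹ = 0` makes constants vanish. -/
theorem divWeight_of_weight {k : ℕ} {x : FreeCGA deg W}
    (hx : weight deg W x = Polynomial.monomial k x) : divWeight deg W x = (k : ℚ)⁻¹ • x := by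
  change Polynomial.lsum _ (weight deg W x) = _
  rw [hx]
  simp [Polynomial.lsum_apply, Polynomial.sum_monomial_index]

theorem weight_mul {k l : ℕ} {x y : FreeCGA deg W}
    (hx : weight deg W x = Polynomial.monomial k x)
    (hy : weight deg W y = Polynomial.monomial l y) :
    weight deg W (x * y) = Polynomial.monomial (k + l) (x * y) := by
  rw [map_mul, hx, hy, Polynomial.monomial_mul_monomial]

theorem weight_add {k : ℕ} {x y : FreeCGA deg W}
    (hx : weight deg W x = Polynomial.monomial k x)
    (hy : weight deg W y = Polynomial.monomial k y) :
    weight deg W (x + y) = Polynomial.monomial k (x + y) := by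
  rw [map_add, hx, hy, map_add]

theorem weight_smul {k : ℕ} {x : FreeCGA deg W} (c : ℚ)
    (hx : weight deg W x = Polynomial.monomial k x) :
    weight deg W (c • x) = Polynomial.monomial k (c • x) := by
  rw [map_smul, hx, Polynomial.smul_monomial]

end FreeCGA

namespace CDGA

/-! ### The contracting homotopy of `Λ(V ⊕ sV)`. -/

section contract

variable (V : ℕ → Type u) [∀ n, AddCommGroup (V n)] [∀ n, Module ℚ (V n)]

/-- The contraction `s v ↦ v`, `v ↦ 0` on the generators of `Λ(V ⊕ sV)`. -/
noncomputable def acη : ∀ i : ℕ × Bool, V i.1 →ₗ[ℚ] FreeCGA acDeg (fun i : ℕ × Bool => V i.1)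
  | (_, false) => 0
  | (n, true) => FreeCGA.gen acDeg (fun i : ℕ × Bool => V i.1) (n, false)

/-- The degrees `|s v| + 1 = n + 2` and `|v| = n` have the same parity, so this is graded
commutativity with `v`. -/
theorem acη_comm (i j : ℕ × Bool) (v : V i.1) (w : V j.1) :
    FreeCGA.gen acDeg (fun i : ℕ × Bool => V i.1) i v * acη V j w
      = (-1 : ℚ) ^ (acDeg i * (acDeg j + 1)) •
        (acη V j w * FreeCGA.gen acDeg (fun i : ℕ × Bool => V i.1) i v) := by
  obtain ⟨n, _ | _⟩ := j
  · simp [acη]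
  · rw [sign_eq (show acDeg i * (acDeg (n, true) + 1) = acDeg i * acDeg (n, false) + 2 * acDeg i from
      show acDeg i * (n + 1 + 1) = acDeg i * n + 2 * acDeg i by ring)]
    exact FreeCGA.gen_comm acDeg (fun i : ℕ × Bool => V i.1) i (n, false) v w

/-- The derivation of degree `-1` of `Λ(V ⊕ sV)` with `s v ↦ v`, `v ↦ 0`. -/
noncomputable def contract : FreeCGA acDeg (fun i : ℕ × Bool => V i.1) →ₗ[ℚ]
    FreeCGA acDeg (fun i : ℕ × Bool => V i.1) :=
  FreeCGA.oddDeriv acDeg (fun i : ℕ × Bool => V i.1) (acη V) (acη_comm V)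

/-- The differential of `Λ(V ⊕ sV)`. -/
noncomputable abbrev acD : FreeCGA acDeg (fun i : ℕ × Bool => V i.1) →ₗ[ℚ]
    FreeCGA acDeg (fun i : ℕ × Bool => V i.1) :=
  FreeCGA.deriv acDeg (fun i : ℕ × Bool => V i.1) (acδ V) (acδ_mem V)

theorem acD_gen_mul (i : ℕ × Bool) (v : V i.1) (l : List (Σ i : ℕ × Bool, V i.1)) :
    acD V (FreeCGA.gen acDeg (fun i : ℕ × Bool => V i.1) i v * FreeCGA.word acDeg _ l)
      = acδ V i v * FreeCGA.word acDeg _ l + (-1 : ℚ) ^ acDeg i •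
        (FreeCGA.gen acDeg (fun i : ℕ × Bool => V i.1) i v * acD V (FreeCGA.word acDeg _ l)) := by
  rw [acD, FreeCGA.deriv_mul _ _ _ _ (FreeCGA.gen_mem acDeg (fun i : ℕ × Bool => V i.1) i v)
    (FreeCGA.word_mem acDeg (fun i : ℕ × Bool => V i.1) l), FreeCGA.deriv_gen]

theorem acD_one : acD V 1 = 0 := (acyclic V).one_mem_Z.2

/-- The differential is linear on generators, so each term of the Leibniz rule replaces one letter
by one letter or by zero. The same holds for the contraction, and hence division by the length is
compatible with both. -/
theorem acD_weight (l : List (Σ i : ℕ × Bool, V i.1)) :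
    FreeCGA.weight acDeg (fun i : ℕ × Bool => V i.1) (acD V (FreeCGA.word acDeg _ l))
      = Polynomial.monomial l.length (acD V (FreeCGA.word acDeg _ l)) := by
  induction l with
  | nil =>
    have h : FreeCGA.word acDeg (fun i : ℕ × Bool => V i.1) [] = 1 := by simp [FreeCGA.word]
    rw [h, acD_one]; simp
  | cons x l ih =>
    rw [FreeCGA.word_cons, acD_gen_mul, List.length_cons, add_comm l.length 1]
    refine FreeCGA.weight_add _ _ (FreeCGA.weight_mul _ _ ?_ (FreeCGA.weight_word _ _ _))
      (FreeCGA.weight_smul _ _ _ (FreeCGA.weight_mul _ _ (FreeCGA.weight_gen _ _ _ _) ih))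
    obtain ⟨⟨n, _ | _⟩, v⟩ := x
    · exact FreeCGA.weight_gen acDeg (fun i : ℕ × Bool => V i.1) (n, true) v
    · simp [acδ]

theorem contract_weight (l : List (Σ i : ℕ × Bool, V i.1)) :
    FreeCGA.weight acDeg (fun i : ℕ × Bool => V i.1) (contract V (FreeCGA.word acDeg _ l))
      = Polynomial.monomial l.length (contract V (FreeCGA.word acDeg _ l)) := by
  induction l with
  | nil =>
    have h : FreeCGA.word acDeg (fun i : ℕ × Bool => V i.1) [] = 1 := by simp [FreeCGA.word]
    rw [h, contract, FreeCGA.oddDeriv_one]; simp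
  | cons x l ih =>
    rw [FreeCGA.word_cons, contract, FreeCGA.oddDeriv_gen_mul, List.length_cons,
      add_comm l.length 1]
    refine FreeCGA.weight_add _ _ (FreeCGA.weight_mul _ _ ?_ (FreeCGA.weight_word _ _ _))
      (FreeCGA.weight_smul _ _ _ (FreeCGA.weight_mul _ _ (FreeCGA.weight_gen _ _ _ _) ih))
    obtain ⟨⟨n, _ | _⟩, v⟩ := x
    · simp [acη]
    · exact FreeCGA.weight_gen acDeg (fun i : ℕ × Bool => V i.1) (n, false) v

/-- Euler's formula: the anticommutator of the differential with the contraction counts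
generators. -/
theorem contract_homotopy (l : List (Σ i : ℕ × Bool, V i.1)) :
    acD V (contract V (FreeCGA.word acDeg _ l)) + contract V (acD V (FreeCGA.word acDeg _ l))
      = (l.length : ℚ) • FreeCGA.word acDeg (fun i : ℕ × Bool => V i.1) l := by
  induction l with
  | nil =>
    have h : FreeCGA.word acDeg (fun i : ℕ × Bool => V i.1) [] = 1 := by simp [FreeCGA.word]
    rw [h, acD_one, contract, FreeCGA.oddDeriv_one]; simp
  | cons x l ih =>
    have key : ∀ (i : ℕ × Bool) (v : V i.1) (y : FreeCGA acDeg (fun i : ℕ × Bool => V i.1)),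
        contract V (FreeCGA.gen acDeg (fun i : ℕ × Bool => V i.1) i v * y)
          = acη V i v * y + (-1 : ℚ) ^ acDeg i •
            (FreeCGA.gen acDeg (fun i : ℕ × Bool => V i.1) i v * contract V y) :=
      FreeCGA.oddDeriv_gen_mul acDeg (fun i : ℕ × Bool => V i.1) (acη V) (acη_comm V)
    -- The differential is also applied to a generator times the contraction of a word, which is not
    -- a word; linearity extends the rule to all right factors.
    have key' : ∀ (i : ℕ × Bool) (v : V i.1) (y : FreeCGA acDeg (fun i : ℕ × Bool => V i.1)),
        acD V (FreeCGA.gen acDeg (fun i : ℕ × Bool => V i.1) i v * y)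
          = acδ V i v * y + (-1 : ℚ) ^ acDeg i •
            (FreeCGA.gen acDeg (fun i : ℕ × Bool => V i.1) i v * acD V y) := by
      intro i v y
      induction y using FreeCGA.word_induction with
      | h0 => simp
      | hw l => exact acD_gen_mul V i v l
      | ha x y hx hy => rw [mul_add, map_add, hx, hy, mul_add, map_add, mul_add]; module
      | hs c x hx => rw [mul_smul_comm, map_smul, hx, mul_smul_comm, map_smul, mul_smul_comm]; module
    have e : ∀ n : ℕ, (-1 : ℚ) ^ n * (-1 : ℚ) ^ n = 1 := fun n => by rw [← mul_pow]; simp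
    have ih' := congrArg (FreeCGA.gen acDeg (fun i : ℕ × Bool => V i.1) x.1 x.2 * ·) ih
    simp only [mul_add, mul_smul_comm] at ih'
    -- In both cases the mixed terms, where one operator hits the first letter and the other hits
    -- the rest, cancel. What remains is the word itself, once, plus the first letter times the
    -- formula for the rest.
    obtain ⟨⟨n, _ | _⟩, v⟩ := x
    · have k0 := key (n, false) v
      have k1 := key (n, true) v
      have d0 := key' (n, false) v
      simp only [acη, acδ, acDeg, LinearMap.zero_apply, zero_mul, zero_add, Bool.false_eq_true,
        if_false, if_true, pow_succ] at k0 k1 d0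
      rw [FreeCGA.word_cons, k0, map_smul, d0, d0, map_add, k1, map_smul, k0, List.length_cons,
        Nat.cast_succ, add_smul, one_smul, ← ih']
      simp only [smul_add, smul_smul, e]
      module
    · have k1 := key (n, true) v
      have d0 := key' (n, false) v
      have d1 := key' (n, true) v
      simp only [acη, acδ, acDeg, LinearMap.zero_apply, zero_mul, zero_add, Bool.false_eq_true,
        if_false, if_true] at k1 d0 d1
      rw [FreeCGA.word_cons, k1, map_add, map_smul, d1, d0, d1, map_smul, k1, List.length_cons,
        Nat.cast_succ, add_smul, one_smul, ← ih']
      simp only [smul_add, smul_smul, e]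
      rw [pow_succ]
      module

theorem acyclic_induction {p : acyclic V → Prop} (h0 : p 0)
    (hw : ∀ l, p (FreeCGA.word acDeg (fun i : ℕ × Bool => V i.1) l))
    (ha : ∀ x y : acyclic V, p x → p y → p (x + y))
    (hs : ∀ (c : ℚ) (x : acyclic V), p x → p (c • x)) (x : acyclic V) : p x :=
  FreeCGA.word_induction acDeg (fun i : ℕ × Bool => V i.1) (p := p) h0 hw ha hs x

theorem contract_divWeight (x : FreeCGA acDeg (fun i : ℕ × Bool => V i.1)) :
    FreeCGA.divWeight acDeg (fun i : ℕ × Bool => V i.1) (contract V x)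
      = contract V (FreeCGA.divWeight acDeg (fun i : ℕ × Bool => V i.1) x) := by
  induction x using FreeCGA.word_induction with
  | h0 => simp only [map_zero]
  | hw l =>
    rw [FreeCGA.divWeight_of_weight _ _ (contract_weight V l),
      FreeCGA.divWeight_of_weight _ _ (FreeCGA.weight_word _ _ l), map_smul]
  | ha x y hx hy => simp only [map_add, hx, hy]
  | hs c x hx => simp only [map_smul, hx]

/-- Both summands carry the same factor, the inverse of the length. Euler's formula thus becomes the
identity on nonempty words, and on the empty word both sides are zero. -/
theorem divWeight_contract_homotopy (l : List (Σ i : ℕ × Bool, V i.1)) :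
    acD V (FreeCGA.divWeight acDeg (fun i : ℕ × Bool => V i.1)
        (contract V (FreeCGA.word acDeg _ l)))
      + FreeCGA.divWeight acDeg (fun i : ℕ × Bool => V i.1)
        (contract V (acD V (FreeCGA.word acDeg _ l)))
      = FreeCGA.word acDeg (fun i : ℕ × Bool => V i.1) l - if l = [] then 1 else 0 := by
  rw [contract_divWeight, contract_divWeight,
    FreeCGA.divWeight_of_weight _ _ (FreeCGA.weight_word _ _ l),
    FreeCGA.divWeight_of_weight _ _ (acD_weight V l), map_smul, map_smul, map_smul, ← smul_add,
    contract_homotopy, smul_smul]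
  cases l with
  | nil => simp [FreeCGA.word]
  | cons x l =>
    rw [if_neg (List.cons_ne_nil _ _), inv_mul_cancel₀ (Nat.cast_ne_zero.2 (by simp)), one_smul,
      sub_zero]

/-- The contracting homotopy of `Λ(V ⊕ sV)`. -/
noncomputable def acHomotopy : acyclic V →ₗ[ℚ] acyclic V :=
  (FreeCGA.divWeight acDeg (fun i : ℕ × Bool => V i.1)) ∘ₗ contract V

/-- The augmentation of `Λ(V ⊕ sV)`, as an endomorphism. -/
noncomputable def acAug : acyclic V ⟶ acyclic V :=
  acLift (fun _ => 0) (fun _ _ => zero_mem _)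

theorem acAug_gen (i : ℕ × Bool) (v : V i.1) :
    (acAug V).toAlgHom (FreeCGA.gen acDeg (fun i : ℕ × Bool => V i.1) i v) = 0 := by
  refine (acLiftHom_gen (C := acyclic V) (fun _ => 0) (fun _ _ => zero_mem _) i v).trans ?_
  obtain ⟨n, _ | _⟩ := i
  · rfl
  · exact map_zero (acyclic V).d

theorem acAug_word (l : List (Σ i : ℕ × Bool, V i.1)) :
    (acAug V).toAlgHom (FreeCGA.word acDeg (fun i : ℕ × Bool => V i.1) l)
      = if l = [] then 1 else 0 := by
  cases l with
  | nil => exact map_one _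
  | cons x l =>
    rw [FreeCGA.word_cons, if_neg (List.cons_ne_nil _ _)]
    refine (map_mul (acAug V).toAlgHom _ _).trans ?_
    rw [acAug_gen]
    exact zero_mul (_ : acyclic V)

theorem acHomotopy_spec (x : acyclic V) :
    (acyclic V).d (acHomotopy V x) + acHomotopy V ((acyclic V).d x)
      = x - (acAug V).toAlgHom x := by
  induction x using acyclic_induction with
  | h0 => simp only [map_zero, sub_zero, add_zero]
  | hw l =>
    rw [acAug_word]
    exact divWeight_contract_homotopy V l
  | ha x y hx hy =>
    rw [map_add, map_add, map_add, map_add, map_add, add_sub_add_comm, ← hx, ← hy]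
    abel
  | hs c x hx =>
    rw [map_smul, map_smul, map_smul, map_smul, map_smul, ← smul_sub, ← hx, smul_add]

/-- A scalar value can be moved across the tensor sign to the left factor, which
`tensorHomotopy_spec` needs. -/
theorem acAug_mem (x : acyclic V) : ∃ c : ℚ, (acAug V).toAlgHom x = c • (1 : acyclic V) := by
  induction x using acyclic_induction with
  | h0 => exact ⟨0, by rw [map_zero, zero_smul]⟩
  | hw l =>
    rw [acAug_word]
    split_ifs
    · exact ⟨1, (one_smul _ _).symm⟩
    · exact ⟨0, (zero_smul _ _).symm⟩
  | ha x y hx hy =>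
    obtain ⟨a, ha⟩ := hx
    obtain ⟨b, hb⟩ := hy
    exact ⟨a + b, by rw [map_add, ha, hb, add_smul]⟩
  | hs c x hx =>
    obtain ⟨a, ha⟩ := hx
    exact ⟨c * a, by rw [map_smul, ha, smul_smul]⟩

end contract

/-! ### Quasi-isomorphisms -/

theorem mapH_cls {A B : CDGA.{u}} (f : A ⟶ B) {n : ℕ} (x : A.Z n) :
    Hom.mapH f n (A.cls x) = B.cls (Hom.mapZ f n x) := rfl

/-- The element `z` need not be homogeneous, since coboundaries are defined as the degree `n`
elements of the full range of `d`. Hence the degrees of the homotopies never have to be tracked. -/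
theorem cls_eq_iff (A : CDGA.{u}) {n : ℕ} (x y : A.Z n) :
    A.cls x = A.cls y ↔ ∃ z, A.d z = (x : A) - y := by
  refine (Submodule.Quotient.eq _).trans ⟨fun h => h.2, fun h => ⟨?_, h⟩⟩
  exact sub_mem x.2.1 y.2.1

theorem mapH_comp {A B C : CDGA.{u}} (f : A ⟶ B) (g : B ⟶ C) (n : ℕ) :
    ⇑(Hom.mapH (f ≫ g) n) = Hom.mapH g n ∘ Hom.mapH f n := by
  funext x
  obtain ⟨x, rfl⟩ := Submodule.mkQ_surjective _ x
  rfl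

theorem IsQuasiIso.comp {A B C : CDGA.{u}} {f : A ⟶ B} {g : B ⟶ C} (hf : IsQuasiIso f)
    (hg : IsQuasiIso g) : IsQuasiIso (f ≫ g) := fun n => by
  rw [mapH_comp]
  exact (hg n).comp (hf n)

theorem IsQuasiIso.of_comp_left {A B C : CDGA.{u}} {f : A ⟶ B} {g : B ⟶ C} (hf : IsQuasiIso f)
    (h : IsQuasiIso (f ≫ g)) : IsQuasiIso g := fun n => by
  have := h n
  rw [mapH_comp] at this
  exact (Function.Bijective.of_comp_iff _ (hf n)).1 this

theorem isQuasiIso_id (A : CDGA.{u}) : IsQuasiIso (𝟙 A) := fun n => by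
  have : ⇑(Hom.mapH (𝟙 A) n) = id := by
    funext x
    obtain ⟨x, rfl⟩ := Submodule.mkQ_surjective _ x
    rfl
  rw [this]
  exact Function.bijective_id

/-! ### Tensoring with `Λ(V ⊕ sV)` preserves cohomology. -/

section tensor

variable (A : CDGA.{u}) (V : ℕ → Type u) [∀ n, AddCommGroup (V n)] [∀ n, Module ℚ (V n)]

/-- The retraction of `A ⊗ Λ(V ⊕ sV)` to `A`. -/
noncomputable def tensorRetract : tensor A (acyclic V) ⟶ A :=
  tensorLift (𝟙 A) (acLift (fun _ => 0) (fun _ _ => zero_mem _))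

theorem tensorRetract_inl (a : A) :
    (tensorRetract A V).toAlgHom ((inl A (acyclic V)).toAlgHom a) = a :=
  tensorLift_inl _ _ a

theorem inl_injective : Function.Injective (inl A (acyclic V)).toAlgHom :=
  Function.LeftInverse.injective (tensorRetract_inl A V)

/-- Without generators the retraction is a two-sided inverse, as morphisms out of the tensor product
are determined on the two factors. This serves the orbits that an enlargement leaves unchanged. -/
theorem inl_surjective (hV : ∀ n (v : V n), v = 0) :
    Function.Surjective (inl A (acyclic V)).toAlgHom := by
  have h : tensorRetract A V ≫ inl A (acyclic V) = 𝟙 _ := by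
    refine tensor_hom_ext (CDGA.hom_ext fun x => ?_) (acyclic_hom_ext fun n v => ?_)
    · rw [comp_apply, comp_apply, tensorRetract_inl]; rfl
    · rw [hV n v, map_zero, map_zero, map_zero]
  intro x
  exact ⟨(tensorRetract A V).toAlgHom x, congrArg (fun f => f.toAlgHom x) h⟩

/-- The contracting homotopy of `A ⊗ Λ(V ⊕ sV)` onto `A`. -/
noncomputable def tensorHomotopy : T A (acyclic V) →ₗ[ℚ] T A (acyclic V) :=
  (GradedTensorProduct.of ℚ A.gr (acyclic V).gr).toLinearMap ∘ₗ
    (TensorProduct.map (sgn A) (acHomotopy V)) ∘ₗ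
    (GradedTensorProduct.of ℚ A.gr (acyclic V).gr).symm.toLinearMap

theorem tensorHomotopy_tmul {i : ℕ} {a : A} (ha : a ∈ A.gr i) (b : acyclic V) :
    tensorHomotopy A V (a ᵍ⊗ₜ[ℚ] b) = (-1 : ℚ) ^ i • (a ᵍ⊗ₜ[ℚ] acHomotopy V b) := by
  have : tensorHomotopy A V (a ᵍ⊗ₜ[ℚ] b) = sgn A a ᵍ⊗ₜ[ℚ] acHomotopy V b := rfl
  rw [this, sgn_apply ha]
  rfl

/-- The sign `(-1) ^ |a|` in the homotopy makes the terms with `A.d a` cancel, leaving `a ⊗ (d h + h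
d) b`. By `acHomotopy_spec` this is `a ⊗ b` minus `a` tensored with the augmentation of `b`. -/
theorem tensorHomotopy_spec (x : T A (acyclic V)) :
    ∃ a : A, td A (acyclic V) (tensorHomotopy A V x) + tensorHomotopy A V (td A (acyclic V) x)
      = x - a ᵍ⊗ₜ[ℚ] (1 : acyclic V) := by
  induction x using tensor_induction with
  | h0 => exact ⟨0, by simp [GradedTensorProduct.tmul]⟩
  | h1 i j a ha b hb =>
    obtain ⟨c, hc⟩ := acAug_mem V b
    have hs := acHomotopy_spec V b
    rw [hc] at hs
    have e : (-1 : ℚ) ^ i * (-1 : ℚ) ^ i = 1 := by rw [← mul_pow]; simp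
    have h : td A (acyclic V) (tensorHomotopy A V (a ᵍ⊗ₜ[ℚ] b))
        + tensorHomotopy A V (td A (acyclic V) (a ᵍ⊗ₜ[ℚ] b))
        = a ᵍ⊗ₜ[ℚ] (acyclic V).d (acHomotopy V b) + a ᵍ⊗ₜ[ℚ] acHomotopy V ((acyclic V).d b) := by
      rw [tensorHomotopy_tmul A V ha, td_tmul ha, map_smul, td_tmul ha, map_add, map_smul,
        tensorHomotopy_tmul A V ha, tensorHomotopy_tmul A V (A.d_mem ha), smul_add, smul_smul,
        smul_smul, e, pow_succ]
      module
    refine ⟨c • a, ?_⟩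
    rw [h]
    simp only [GradedTensorProduct.tmul]
    rw [← map_add, ← TensorProduct.tmul_add, hs, TensorProduct.tmul_sub, map_sub,
      TensorProduct.smul_tmul]
  | h2 x y hx hy =>
    obtain ⟨a, ha⟩ := hx
    obtain ⟨b, hb⟩ := hy
    refine ⟨a + b, ?_⟩
    have : ((a + b) ᵍ⊗ₜ[ℚ] (1 : acyclic V) : T A (acyclic V))
        = a ᵍ⊗ₜ[ℚ] (1 : acyclic V) + b ᵍ⊗ₜ[ℚ] (1 : acyclic V) := by
      simp only [GradedTensorProduct.tmul, TensorProduct.add_tmul, map_add]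
    rw [map_add, map_add, map_add, map_add, this, add_sub_add_comm, ← ha, ← hb]
    abel

theorem exists_homotopy (x : tensor A (acyclic V)) (hx : (tensor A (acyclic V)).d x = 0) :
    ∃ (a : A) (z : tensor A (acyclic V)),
      (tensor A (acyclic V)).d z = x - (inl A (acyclic V)).toAlgHom a := by
  obtain ⟨a, ha⟩ := tensorHomotopy_spec A V x
  refine ⟨a, tensorHomotopy A V x, Eq.trans ?_ ha⟩
  have : tensorHomotopy A V (td A (acyclic V) x) = 0 :=
    (congrArg (tensorHomotopy A V) hx).trans (map_zero _)
  rw [this, add_zero]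
  rfl

theorem isQuasiIso_inl : IsQuasiIso (inl A (acyclic V)) := by
  intro n
  constructor
  · have h : inl A (acyclic V) ≫ tensorRetract A V = 𝟙 A := hom_ext (tensorRetract_inl A V)
    have := (isQuasiIso_id A n).1
    rw [← h, mapH_comp] at this
    exact this.of_comp
  · intro y
    obtain ⟨y, rfl⟩ := Submodule.mkQ_surjective _ y
    obtain ⟨a, z, ha⟩ := exists_homotopy A V y y.2.2
    -- The element `a` is not known to be homogeneous. Retracting the homotopy relation shows that
    -- it differs from the retract of `y`, a cocycle of degree `n`, by a boundary, so that retract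
    -- serves as preimage.
    have hr := congrArg (tensorRetract A V).toAlgHom ha
    rw [map_sub, tensorRetract_inl, (tensorRetract A V).map_d] at hr
    refine ⟨A.cls (Hom.mapZ (tensorRetract A V) n y), ?_⟩
    rw [mapH_cls]
    refine ((cls_eq_iff _ _ _).2 ?_)
    -- The boundaries of the two terms both involve the image of `a`, which cancels in the
    -- difference.
    refine ⟨(inl A (acyclic V)).toAlgHom ((tensorRetract A V).toAlgHom z) - z, ?_⟩
    rw [map_sub, ha, ← (inl A (acyclic V)).map_d, hr, map_sub]
    change _ = (inl A (acyclic V)).toAlgHom ((tensorRetract A V).toAlgHom y) - _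
    abel

end tensor

end CDGA

namespace DGADiagram

open CDGA

variable {G : Type u} [Group G]

theorem naturality_apply {U V : DGADiagram G} (r : U ⟶ V) {K K' : OrbitCat G} (α : K ⟶ K')
    (x : U.obj K) : (r.app K').toAlgHom ((U.map α).toAlgHom x)
      = (V.map α).toAlgHom ((r.app K).toAlgHom x) :=
  congrArg (fun f => Hom.toAlgHom f x) (r.naturality α)

theorem mem_kerSub (U : DGADiagram G) {H : OrbitCat G} {x : U.obj H} : x ∈ kerSub U H ↔
    ∀ (K : OrbitCat G) (_ : IsEmpty (H ≅ K)) (α : H ⟶ K), (U.map α).toAlgHom x = 0 :=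
  ⟨fun hx _ hK α => map_kerSub U H hK α hx, fun h => by
    simp only [kerSub, Submodule.mem_iInf]
    exact h⟩

/-! ### Functoriality of the envelope -/

section functoriality

variable {U V : DGADiagram G} (r : U ⟶ V) (H : OrbitCat G)

theorem app_mem_kerSub {x : U.obj H} (hx : x ∈ kerSub U H) :
    (r.app H).toAlgHom x ∈ kerSub V H := by
  refine (mem_kerSub V).2 fun K hK α => ?_
  rw [← naturality_apply, map_kerSub U H hK α hx, map_zero]

/-- The map of the systems `coind` induced by a map of diagrams. -/
def coindApp (K : OrbitCat G) (n : ℕ) : coind U H K n →ₗ[ℚ] coind V H K n where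
  toFun f := ⟨fun φ => (r.app H).toAlgHom (f.1 φ),
    fun φ => ⟨(r.app H).map_gr (f.2.1 φ).1, app_mem_kerSub r H (f.2.1 φ).2⟩, fun φ w =>
      (congrArg _ (f.2.2 φ w)).trans (naturality_apply r w (f.1 φ))⟩
  map_add' _ _ := Subtype.ext (funext fun _ => map_add _ _ _)
  map_smul' _ _ := Subtype.ext (funext fun _ => map_smul _ _ _)

theorem app_evalIso (K : OrbitCat G) {n : ℕ} (f : coind U H K n) :
    (r.app K).toAlgHom (evalIso U H K n f) = evalIso V H K n (coindApp r H K n f) := by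
  by_cases h : Nonempty (K ≅ H)
  · obtain ⟨e⟩ := h
    rw [evalIso_eq U H e, evalIso_eq V H e, naturality_apply]
    rfl
  · rw [evalIso_zero U H h, evalIso_zero V H h, map_zero]

/-- The map of enlargements induced by a map of diagrams, at one orbit. -/
noncomputable def enlargeApp (K : OrbitCat G) : enlargeObj U H K ⟶ enlargeObj V H K :=
  tensorLift (r.app K ≫ oldIncl V H K)
    (acLift (fun n => toEnlarge V H K n ∘ₗ coindApp r H K n ∘ₗ (newGen U H K n).subtype)
      (fun _ _ => toEnlarge_mem V H K _))

theorem enlargeApp_inl (K : OrbitCat G) (x : U.obj K) :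
    (enlargeApp r H K).toAlgHom ((oldIncl U H K).toAlgHom x)
      = (oldIncl V H K).toAlgHom ((r.app K).toAlgHom x) :=
  tensorLift_inl _ _ x

/-- `toEnlarge` treats new generators and elements already present in `U` uniformly, so naturality
of `enlargeHom` reduces to one computation, with no case distinction on the orbits. -/
theorem enlargeApp_toEnlarge (K : OrbitCat G) {n : ℕ} (f : coind U H K n) :
    (enlargeApp r H K).toAlgHom (toEnlarge U H K n f)
      = toEnlarge V H K n (coindApp r H K n f) := by
  by_cases h : Below K H
  · have h1 := toEnlarge_newGen U H ⟨f, fun h' => absurd h h'⟩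
    rw [h1, enlargeApp]
    exact (tensorLift_inr _ _ _).trans (acLift_gen _ _ n _)
  · rw [toEnlarge_not_below U H h, enlargeApp_inl, app_evalIso, toEnlarge_not_below V H h]

variable [Finite G]

/-- The map of enlargements induced by a map of diagrams. -/
noncomputable def enlargeHom : enlarge U H ⟶ enlarge V H where
  app := enlargeApp r H
  naturality K K' α := by
    refine enlarge_hom_ext U H (fun x => ?_) (fun n x => ?_)
    · change (enlargeApp r H K').toAlgHom ((enlargeMap U H α).toAlgHom _)
        = (enlargeMap V H α).toAlgHom ((enlargeApp r H K).toAlgHom _)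
      rw [enlargeMap_inl, enlargeApp_inl, enlargeApp_inl, enlargeMap_inl, naturality_apply]
    · change (enlargeApp r H K').toAlgHom ((enlargeMap U H α).toAlgHom _)
        = (enlargeMap V H α).toAlgHom ((enlargeApp r H K).toAlgHom _)
      rw [enlargeMap_toEnlarge, enlargeApp_toEnlarge, enlargeApp_toEnlarge, enlargeMap_toEnlarge]
      rfl

theorem enlargeIncl_enlargeHom : enlargeIncl U H ≫ enlargeHom r H = r ≫ enlargeIncl V H :=
  NatTrans.ext (funext fun K => CDGA.hom_ext fun x => enlargeApp_inl r H K x)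

theorem exists_envelopeHom (L : List (OrbitCat G)) {U V : DGADiagram G} (r : U ⟶ V) :
    ∃ φ : envelope L U ⟶ envelope L V, envelopeIncl L U ≫ φ = r ≫ envelopeIncl L V := by
  induction L generalizing U V with
  | nil => exact ⟨r, (Category.id_comp r).trans (Category.comp_id r).symm⟩
  | cons H L ih =>
    obtain ⟨φ, hφ⟩ := ih (enlargeHom r H)
    refine ⟨φ, ?_⟩
    change (enlargeIncl U H ≫ envelopeIncl L (enlarge U H)) ≫ φ
      = r ≫ enlargeIncl V H ≫ envelopeIncl L (enlarge V H)
    rw [Category.assoc, hφ, ← Category.assoc, enlargeIncl_enlargeHom, Category.assoc]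

end functoriality

/-! ### The inclusion in the envelope is a quasi-isomorphism -/

theorem isQuasiIso_enlargeIncl [Finite G] (U : DGADiagram G) (H : OrbitCat G) :
    IsQuasiIso (enlargeIncl U H) :=
  fun K => isQuasiIso_inl (U.obj K) (fun n => newGen U H K n)

theorem isQuasiIso_envelopeIncl [Finite G] (L : List (OrbitCat G)) (U : DGADiagram G) :
    IsQuasiIso (envelopeIncl L U) := by
  induction L generalizing U with
  | nil => exact fun K => isQuasiIso_id _
  | cons H L ih => exact fun K => (isQuasiIso_enlargeIncl U H K).comp (ih _ K)

theorem WeaklyEquivalent.sameRationalHomotopyType {U V : DGADiagram G}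
    (h : WeaklyEquivalent U V) (K : OrbitCat G) :
    SameRationalHomotopyType (U.obj K) (V.obj K) := by
  induction h with
  | rel U V h =>
    obtain ⟨-, -, f, hf⟩ := h
    exact .rel _ _ ⟨f.app K, hf K⟩
  | refl U => exact .refl _
  | symm U V _ ih => exact .symm _ _ ih
  | trans U V W _ _ ih ih' => exact .trans _ _ _ ih ih'

/-! ### Injectivity -/

section injective

/-- Equivariant maps into a transitive `G`-set are surjective, and surjective self-maps of a finite
set are bijective. Averaging over automorphisms therefore yields equivariance under all
endomorphisms. -/
theorem isIso_of_endo [Finite G] {H : OrbitCat G} (w : H ⟶ H) : IsIso w := by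
  let w' : (G ⧸ H.sub) →[G] (G ⧸ H.sub) := w
  have hs : Function.Surjective w' := by
    intro y
    obtain ⟨a, ha⟩ := MulAction.exists_smul_eq G (w' ((1 : G) : G ⧸ H.sub)) y
    exact ⟨a • ((1 : G) : G ⧸ H.sub), by rw [map_smul, ha]⟩
  let e := Equiv.ofBijective w' ⟨Finite.injective_iff_surjective.2 hs, hs⟩
  refine ⟨MulActionHom.inverse w' e.symm e.left_inv e.right_inv, ?_, ?_⟩
  · exact MulActionHom.ext e.left_inv
  · exact MulActionHom.ext e.right_inv

instance finite_hom [Finite G] (H K : OrbitCat G) : Finite (H ⟶ K) :=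
  Finite.of_injective (β := G ⧸ H.sub → G ⧸ K.sub) (fun f => MulActionHom.toFun f)
    fun _ _ h => MulActionHom.ext (congrFun h)

instance finite_iso [Finite G] (H K : OrbitCat G) : Finite (H ≅ K) :=
  Finite.of_injective (fun e : H ≅ K => e.hom) fun _ _ h => Iso.ext h

theorem not_below_self (H : OrbitCat G) : ¬ Below H H := fun h => h.2.false (Iso.refl H)

theorem map_mem_kerSub (F : DGADiagram G) {H : OrbitCat G} (w : H ⟶ H) {x : F.obj H}
    (hx : x ∈ kerSub F H) : (F.map w).toAlgHom x ∈ kerSub F H := by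
  refine (mem_kerSub F).2 fun K hK α => ?_
  rw [← CDGA.comp_apply, ← F.map_comp]
  exact map_kerSub F H hK _ hx

/-- Every equivariant linear map to the intersection `kerSub F H` of the kernels extends to a map of
coefficient systems, which can be chosen to vanish at the orbits without a map to `G ⧸ H`. -/
def ExtendsFrom (F : DGADiagram G) (H : OrbitCat G) : Prop :=
  ∀ (Y : OrbitCat G ⥤ ModuleCat.{u} ℚ) (q : Y.obj H →ₗ[ℚ] F.obj H), (∀ y, q y ∈ kerSub F H) →
    (∀ (w : H ⟶ H) (y : Y.obj H), q ((Y.map w).hom y) = (F.map w).toAlgHom (q y)) →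
    ∃ t : Y ⟶ F ⋙ forgetCDGA, (∀ y, (t.app H).hom y = q y) ∧ ∀ K, IsEmpty (K ⟶ H) → t.app K = 0

/-! ### Homogeneous components and pointwise finite sums. -/

theorem map_proj {A B : CDGA.{u}} (f : A ⟶ B) (n : ℕ) (x : A) :
    f.toAlgHom (GradedAlgebra.proj A.gr n x) = GradedAlgebra.proj B.gr n (f.toAlgHom x) := by
  induction x using DirectSum.Decomposition.inductionOn A.gr with
  | zero => simp only [map_zero]
  | @homogeneous i x =>
    simp only [GradedAlgebra.proj_apply]
    by_cases h : i = n
    · subst h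
      rw [DirectSum.decompose_of_mem_same _ x.2, DirectSum.decompose_of_mem_same _ (f.map_gr x.2)]
    · rw [DirectSum.decompose_of_mem_ne _ x.2 h, DirectSum.decompose_of_mem_ne _ (f.map_gr x.2) h,
        map_zero]
  | add x y hx hy => simp only [map_add, hx, hy]

/-- `coind` is built degree by degree, while injectivity concerns ungraded vector spaces. Linear
maps are therefore split into homogeneous components and reassembled as pointwise finite sums. -/
theorem finite_proj (A : CDGA.{u}) (x : A) :
    (Function.support fun n => GradedAlgebra.proj A.gr n x).Finite := by
  classical
  refine (DirectSum.decompose A.gr x).support.finite_toSet.subset fun n hn => ?_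
  simpa [GradedAlgebra.proj_apply] using hn

theorem finsum_proj (A : CDGA.{u}) (x : A) : ∑ᶠ n, GradedAlgebra.proj A.gr n x = x := by
  classical
  rw [finsum_eq_sum_of_support_subset (s := (DirectSum.decompose A.gr x).support)]
  · exact DirectSum.sum_support_decompose A.gr x
  · intro n hn
    simpa [GradedAlgebra.proj_apply] using hn

/-- The sum of a pointwise finite family of linear maps. -/
noncomputable def finsumLinear {X Y : Type u} [AddCommGroup X] [Module ℚ X] [AddCommGroup Y]
    [Module ℚ Y] (f : ℕ → X →ₗ[ℚ] Y) (hf : ∀ x, (Function.support fun n => f n x).Finite) :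
    X →ₗ[ℚ] Y where
  toFun x := ∑ᶠ n, f n x
  map_add' x y := by
    simp only [map_add]
    exact finsum_add_distrib (hf x) (hf y)
  map_smul' c x := by
    simp only [map_smul, RingHom.id_apply]
    exact (smul_finsum c _).symm

/-- Structure maps preserve degrees and so commute with the projections; both the kernel condition
and equivariance pass to homogeneous components. -/
theorem proj_mem_coind {U : DGADiagram G} {H : OrbitCat G} {Y : OrbitCat G ⥤ ModuleCat.{u} ℚ}
    (p : Y.obj H →ₗ[ℚ] U.obj H) (hp : ∀ y, p y ∈ kerSub U H)
    (hw : ∀ (w : H ⟶ H) (y : Y.obj H), p ((Y.map w).hom y) = (U.map w).toAlgHom (p y))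
    (K : OrbitCat G) (n : ℕ) (y : Y.obj K) :
    (fun φ : K ⟶ H => GradedAlgebra.proj (U.obj H).gr n (p ((Y.map φ).hom y))) ∈ coind U H K n := by
  refine ⟨fun φ => ⟨SetLike.coe_mem (DirectSum.decompose (U.obj H).gr _ n), ?_⟩, fun φ w => ?_⟩
  · refine (mem_kerSub U).2 fun K' hK' α => ?_
    rw [map_proj, map_kerSub U H hK' α (hp _), map_zero]
  · change GradedAlgebra.proj (U.obj H).gr n (p ((Y.map (φ ≫ w)).hom y)) = _
    rw [map_proj, ← hw, Y.map_comp]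
    rfl

/-! ### The extension property under further enlargements. -/

theorem oldIncl_injective (U : DGADiagram G) (H K : OrbitCat G) :
    Function.Injective (oldIncl U H K).toAlgHom :=
  inl_injective _ _

theorem oldIncl_surjective (U : DGADiagram G) (H K : OrbitCat G) (h : ¬ Below K H) :
    Function.Surjective (oldIncl U H K).toAlgHom :=
  inl_surjective _ _ fun _ v => Subtype.ext (v.2 h)

variable [Finite G]

/-- At an orbit where the enlargement changes nothing, an equivariant map to the intersection of the
kernels lifts to the original diagram. -/
theorem exists_lift_oldIncl (U : DGADiagram G) {H' H : OrbitCat G} (h : ¬ Below H H')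
    (Y : OrbitCat G ⥤ ModuleCat.{u} ℚ) (q : Y.obj H →ₗ[ℚ] (enlarge U H').obj H)
    (hq : ∀ y, q y ∈ kerSub (enlarge U H') H)
    (hw : ∀ (w : H ⟶ H) (y : Y.obj H),
      q ((Y.map w).hom y) = ((enlarge U H').map w).toAlgHom (q y)) :
    ∃ p : Y.obj H →ₗ[ℚ] U.obj H, (∀ y, (oldIncl U H' H).toAlgHom (p y) = q y) ∧
      (∀ y, p y ∈ kerSub U H) ∧
      ∀ (w : H ⟶ H) (y : Y.obj H), p ((Y.map w).hom y) = (U.map w).toAlgHom (p y) := by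
  let e := LinearEquiv.ofBijective (oldIncl U H' H).toAlgHom.toLinearMap
    ⟨oldIncl_injective U H' H, oldIncl_surjective U H' H h⟩
  have he : ∀ y, (oldIncl U H' H).toAlgHom ((e.symm.toLinearMap ∘ₗ q) y) = q y :=
    fun y => e.apply_symm_apply (q y)
  refine ⟨e.symm.toLinearMap ∘ₗ q, he, fun y => ?_, fun w y => ?_⟩
  · refine (mem_kerSub U).2 fun K hK α => ?_
    -- The inclusion is injective at every orbit, also where the enlargement is strictly larger, so
    -- vanishing may be tested in the enlargement.
    refine oldIncl_injective U H' K ?_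
    have := enlargeMap_inl U H' α ((e.symm.toLinearMap ∘ₗ q) y)
    rw [he] at this
    refine this.symm.trans ((map_kerSub _ H hK α (hq y)).trans (map_zero _).symm)
  · refine oldIncl_injective U H' H ?_
    rw [he, hw, ← enlargeMap_inl, he]
    rfl

/-- The map already takes values in the old diagram, so it is extended there and then included; the
composite vanishes wherever the old extension does. -/
theorem ExtendsFrom.enlarge {U : DGADiagram G} {H H' : OrbitCat G} (hU : ExtendsFrom U H)
    (h : ¬ Below H H') : ExtendsFrom (enlarge U H') H := by
  intro Y q hq hw
  obtain ⟨p, hp, hp', hpw⟩ := exists_lift_oldIncl U h Y q hq hw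
  obtain ⟨t, ht, ht'⟩ := hU Y p hp' hpw
  refine ⟨t ≫ Functor.whiskerRight (enlargeIncl U H') forgetCDGA, fun y => ?_, fun K hK => ?_⟩
  · rw [← hp, ← ht]
    rfl
  · rw [NatTrans.comp_app, ht' K hK, Limits.zero_comp]

/-! ### The extension property created by the enlargement at `H`. -/

section extension

variable {U : DGADiagram G} {H : OrbitCat G} {Y : OrbitCat G ⥤ ModuleCat.{u} ℚ}
  (p : Y.obj H →ₗ[ℚ] U.obj H) (hp : ∀ y, p y ∈ kerSub U H)
  (hw : ∀ (w : H ⟶ H) (y : Y.obj H), p ((Y.map w).hom y) = (U.map w).toAlgHom (p y))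

/-- The map to the system `coind` which corresponds to an equivariant map. -/
noncomputable def toCoind (K : OrbitCat G) (n : ℕ) : Y.obj K →ₗ[ℚ] coind U H K n where
  toFun y := ⟨_, proj_mem_coind p hp hw K n y⟩
  map_add' x y := Subtype.ext (funext fun φ => by simp)
  map_smul' c y := Subtype.ext (funext fun φ => by simp)

/-- There are only finitely many morphisms `K ⟶ H`, each contributing an element with finitely many
nonzero components. -/
theorem finite_toEnlarge_toCoind (K : OrbitCat G) (y : Y.obj K) :
    (Function.support fun n => (toEnlarge U H K n ∘ₗ toCoind p hp hw K n) y).Finite := by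
  refine (Set.finite_iUnion fun φ : K ⟶ H =>
    finite_proj (U.obj H) (p ((Y.map φ).hom y))).subset fun n hn => ?_
  by_contra hc
  simp only [Set.mem_iUnion, Function.mem_support, not_exists, not_not] at hc
  have h0 : toCoind p hp hw K n y = 0 := Subtype.ext (funext hc)
  refine hn ?_
  change toEnlarge U H K n (toCoind p hp hw K n y) = 0
  rw [h0, map_zero]

/-- The map to the enlargement which corresponds to an equivariant map. -/
noncomputable def enlargeExtension : Y ⟶ DGADiagram.enlarge U H ⋙ forgetCDGA where
  app K := ModuleCat.ofHom (X := Y.obj K) (Y := enlargeObj U H K)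
    (finsumLinear (fun n => toEnlarge U H K n ∘ₗ toCoind p hp hw K n)
      (finite_toEnlarge_toCoind p hp hw K))
  naturality K K' α := by
    refine ModuleCat.hom_ext (LinearMap.ext fun y => ?_)
    change ∑ᶠ n, toEnlarge U H K' n (toCoind p hp hw K' n ((Y.map α).hom y))
      = (enlargeMap U H α).toAlgHom (∑ᶠ n, toEnlarge U H K n (toCoind p hp hw K n y))
    refine Eq.trans ?_ (AddMonoidHom.map_finsum
      ((enlargeMap U H α).toAlgHom : enlargeObj U H K →+ enlargeObj U H K')
      (finite_toEnlarge_toCoind p hp hw K y)).symm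
    refine finsum_congr fun n => ?_
    refine Eq.trans ?_ (enlargeMap_toEnlarge U H α _).symm
    refine congrArg _ (Subtype.ext (funext fun φ => ?_))
    change GradedAlgebra.proj (U.obj H).gr n (p ((Y.map φ).hom ((Y.map α).hom y)))
      = GradedAlgebra.proj (U.obj H).gr n (p ((Y.map (α ≫ φ)).hom y))
    rw [Y.map_comp]
    rfl

/-- At `G/H` a coinduced element is identified with its value at the identity, and the homogeneous
components add up to `p y`. -/
theorem enlargeExtension_app_self (y : Y.obj H) :
    ((enlargeExtension p hp hw).app H).hom y = (oldIncl U H H).toAlgHom (p y) := by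
  change ∑ᶠ n, toEnlarge U H H n (toCoind p hp hw H n y) = _
  have h : ∀ n, toEnlarge U H H n (toCoind p hp hw H n y)
      = (oldIncl U H H).toAlgHom (GradedAlgebra.proj (U.obj H).gr n (p y)) := by
    intro n
    rw [toEnlarge_not_below U H (not_below_self H), evalIso_eq U H (Iso.refl H)]
    change (oldIncl U H H).toAlgHom ((U.map (𝟙 H)).toAlgHom
      (GradedAlgebra.proj (U.obj H).gr n (p ((Y.map (𝟙 H)).hom y)))) = _
    rw [U.map_id, Y.map_id]
    rfl
  rw [finsum_congr h]
  refine (AddMonoidHom.map_finsum ((oldIncl U H H).toAlgHom : U.obj H →+ enlargeObj U H H)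
    (finite_proj (U.obj H) (p y))).symm.trans ?_
  rw [finsum_proj]
  rfl

theorem enlargeExtension_app_eq_zero (K : OrbitCat G) (hK : IsEmpty (K ⟶ H)) :
    (enlargeExtension p hp hw).app K = 0 := by
  refine ModuleCat.hom_ext (LinearMap.ext fun y => ?_)
  change ∑ᶠ n, toEnlarge U H K n (toCoind p hp hw K n y) = 0
  refine (finsum_congr fun n => ?_).trans finsum_zero
  have h0 : toCoind p hp hw K n y = 0 := Subtype.ext (funext fun φ => (hK.false φ).elim)
  rw [h0, map_zero]

end extension

theorem extendsFrom_enlarge_self (U : DGADiagram G) (H : OrbitCat G) :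
    ExtendsFrom (DGADiagram.enlarge U H) H := by
  intro Y q hq hw
  obtain ⟨p, hp, hp', hpw⟩ := exists_lift_oldIncl U (not_below_self H) Y q hq hw
  exact ⟨enlargeExtension p hp' hpw,
    fun y => (enlargeExtension_app_self p hp' hpw y).trans (hp y),
    enlargeExtension_app_eq_zero p hp' hpw⟩

theorem ExtendsFrom.envelope {L : List (OrbitCat G)} {U : DGADiagram G} {H : OrbitCat G}
    (hU : ExtendsFrom U H) (h : ∀ H' ∈ L, ¬ Below H H') : ExtendsFrom (envelope L U) H := by
  induction L generalizing U with
  | nil => exact hU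
  | cons H' L ih =>
    rw [List.forall_mem_cons] at h
    exact ih (hU.enlarge h.1) h.2

/-- Enlargements before `H` merely change the starting diagram, the one at `H` creates the property,
and the order of the list ensures that no later one alters the value at `G/H`. -/
theorem extendsFrom_envelope {L : List (OrbitCat G)}
    (hL : L.Pairwise fun H K => ¬ Below H K) (U : DGADiagram G) {H : OrbitCat G} (hH : H ∈ L) :
    ExtendsFrom (DGADiagram.envelope L U) H := by
  induction L generalizing U with
  | nil => cases hH
  | cons H' L ih =>
    rw [List.pairwise_cons] at hL
    rcases List.mem_cons.1 hH with rfl | h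
    · exact (extendsFrom_enlarge_self U H).envelope hL.1
    · exact ih hL.2 _ h

/-! ### Averaging, and induction over the orbits. -/

/-- Equivariant extension of linear maps over the finite group of automorphisms of an orbit. -/
theorem exists_equivariant_extension {X Y F : OrbitCat G ⥤ ModuleCat.{u} ℚ} (g : X ⟶ Y) [Mono g]
    (H : OrbitCat G) (e : X.obj H →ₗ[ℚ] F.obj H)
    (he : ∀ (w : H ⟶ H) x, e ((X.map w).hom x) = (F.map w).hom (e x))
    (S : Submodule ℚ (F.obj H)) (hS : ∀ x, e x ∈ S)
    (hSw : ∀ (w : H ⟶ H), ∀ x ∈ S, (F.map w).hom x ∈ S) :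
    ∃ q : Y.obj H →ₗ[ℚ] F.obj H, (∀ y, q y ∈ S) ∧
      (∀ (w : H ⟶ H) y, q ((Y.map w).hom y) = (F.map w).hom (q y)) ∧
      ∀ x, q ((g.app H).hom x) = e x := by
  have := Fintype.ofFinite (H ≅ H)
  have hg : Function.Injective (g.app H).hom :=
    (ModuleCat.mono_iff_injective _).1 inferInstance
  obtain ⟨l, hl⟩ := LinearMap.exists_leftInverse_of_injective (g.app H).hom
    (LinearMap.ker_eq_bot.2 hg)
  -- Average of the conjugates of `e ∘ l`, where `l` is a linear retraction of `g` at `H`; the order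
  -- of the group is invertible in `ℚ`.
  let q : Y.obj H →ₗ[ℚ] F.obj H := ((Fintype.card (H ≅ H) : ℚ)⁻¹) •
    ∑ w : H ≅ H, (F.map w.inv).hom ∘ₗ (e ∘ₗ l) ∘ₗ (Y.map w.hom).hom
  have hq : ∀ y, q y = ((Fintype.card (H ≅ H) : ℚ)⁻¹) •
      ∑ w : H ≅ H, (F.map w.inv).hom (e (l ((Y.map w.hom).hom y))) := by
    intro y
    simp [q, LinearMap.sum_apply]
  refine ⟨q, fun y => ?_, fun u y => ?_, fun x => ?_⟩
  · rw [hq]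
    exact Submodule.smul_mem _ _ (Submodule.sum_mem _ fun w _ => hSw _ _ (hS _))
  · have := isIso_of_endo u
    rw [hq, hq, map_smul, map_sum]
    congr 1
    -- Composition with the invertible `u` permutes the automorphisms and matches the summands on
    -- the two sides.
    refine Fintype.sum_bijective (fun w : H ≅ H => asIso u ≪≫ w) ?_ _ _ fun w => ?_
    · exact ⟨fun a b h => by simpa using congrArg (fun z => (asIso u).symm ≪≫ z) h,
        fun b => ⟨(asIso u).symm ≪≫ b, by simp⟩⟩
    · have h1 : (Y.map (asIso u ≪≫ w).hom).hom y = (Y.map w.hom).hom ((Y.map u).hom y) := by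
        simp
      have h2 : ∀ z, (F.map u).hom ((F.map (asIso u ≪≫ w).inv).hom z) = (F.map w.inv).hom z := by
        intro z
        rw [← LinearMap.comp_apply, ← ModuleCat.hom_comp, ← F.map_comp]
        simp
      rw [h2, h1]
  · have h : ∀ w : H ≅ H, (F.map w.inv).hom (e (l ((Y.map w.hom).hom ((g.app H).hom x)))) = e x := by
      intro w
      have h1 : (Y.map w.hom).hom ((g.app H).hom x) = (g.app H).hom ((X.map w.hom).hom x) :=
        (congrArg (fun f => f.hom x) (g.naturality w.hom)).symm
      have h2 : l ((g.app H).hom ((X.map w.hom).hom x)) = (X.map w.hom).hom x :=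
        LinearMap.congr_fun hl _
      rw [h1, h2, he, ← LinearMap.comp_apply, ← ModuleCat.hom_comp, ← F.map_comp]
      simp
    rw [hq, Finset.sum_congr rfl fun w _ => h w, Finset.sum_const, Finset.card_univ,
      ← Nat.cast_smul_eq_nsmul ℚ, smul_smul, inv_mul_cancel₀, one_smul]
    have : Nonempty (H ≅ H) := ⟨Iso.refl H⟩
    exact Nat.cast_ne_zero.2 Fintype.card_ne_zero

/-- A map that vanishes above the orbit `G ⧸ H` extends at this orbit along a monomorphism. -/
theorem ExtendsFrom.exists_extension {F : DGADiagram G} {H : OrbitCat G} (hF : ExtendsFrom F H)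
    {X Y : OrbitCat G ⥤ ModuleCat.{u} ℚ} (g : X ⟶ Y) [Mono g] (e : X ⟶ F ⋙ forgetCDGA)
    (he : ∀ K, IsEmpty (H ≅ K) → Nonempty (H ⟶ K) → e.app K = 0) :
    ∃ t : Y ⟶ F ⋙ forgetCDGA, (g ≫ t).app H = e.app H ∧ ∀ K, IsEmpty (K ⟶ H) → t.app K = 0 := by
  have hmem : ∀ x, (e.app H).hom x ∈ kerSub F H := fun x =>
    (mem_kerSub F).2 fun K hK α => by
      have := congrArg (fun f => f.hom x) (e.naturality α)
      rw [he K hK ⟨α⟩, Limits.comp_zero] at this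
      exact this.symm
  obtain ⟨q, hq, hqw, hqg⟩ := exists_equivariant_extension g H (F := F ⋙ forgetCDGA)
    (e.app H).hom (fun w x => congrArg (fun f => f.hom x) (e.naturality w)) (kerSub F H)
    hmem (fun w x hx => map_mem_kerSub F w hx)
  obtain ⟨t, ht, ht'⟩ := hF Y q hq hqw
  refine ⟨t, ModuleCat.hom_ext (LinearMap.ext fun x => ?_), ht'⟩
  exact (ht _).trans (hqg x)

/-- Induction on prefixes of the list: each step corrects the extension at one orbit by a map that
vanishes at the earlier ones. -/
theorem isInjective_of_extendsFrom {L : List (OrbitCat G)} (hL : IsEnlargementOrder L)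
    {F : DGADiagram G} (hF : ∀ H ∈ L, ExtendsFrom F H) : IsInjective F := by
  refine ⟨fun {X Y} f g _ => ?_⟩
  have key : ∀ L₁ : List (OrbitCat G), L₁ <+: L →
      ∃ h : Y ⟶ F ⋙ forgetCDGA, ∀ H ∈ L₁, (f - g ≫ h).app H = 0 := by
    intro L₁
    induction L₁ using List.reverseRecOn with
    | nil => exact fun _ => ⟨0, fun H hH => by cases hH⟩
    | append_singleton L₁ H ih =>
      rintro ⟨L₂, rfl⟩
      obtain ⟨h, hh⟩ := ih ⟨[H] ++ L₂, by simp⟩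
      have hn := hL.nonconj
      have hs := hL.sorted
      rw [List.append_assoc, List.pairwise_append] at hn hs
      -- The listed representative of an orbit strictly above `G/H` cannot be `H` or come later, so
      -- it lies in the prefix already treated; naturality carries the vanishing along the
      -- isomorphism.
      have vanish : ∀ K, IsEmpty (H ≅ K) → Nonempty (H ⟶ K) → (f - g ≫ h).app K = 0 := by
        rintro K hK ⟨α⟩
        obtain ⟨K', hK', ⟨i⟩⟩ := hL.complete K
        have hB : Below H K' := ⟨⟨α ≫ i.inv⟩, ⟨fun j => hK.false (j ≪≫ i)⟩⟩
        have : K' ∈ L₁ := by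
          simp only [List.append_assoc, List.mem_append, List.mem_singleton] at hK'
          rcases hK' with h1 | rfl | h1
          · exact h1
          · exact absurd hB (not_below_self _)
          · exact absurd hB ((List.pairwise_cons.1 hs.2.1).1 _ h1)
        have h2 := (f - g ≫ h).naturality i.inv
        rw [hh K' this, Limits.comp_zero] at h2
        exact Limits.zero_of_comp_mono _ h2.symm
      obtain ⟨t, ht, ht'⟩ := (hF H (by simp)).exists_extension g (f - g ≫ h) vanish
      have split : f - g ≫ (h + t) = (f - g ≫ h) - g ≫ t := by
        rw [Preadditive.comp_add, sub_sub]
      refine ⟨h + t, fun K hK => ?_⟩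
      rw [split, NatTrans.app_sub]
      rcases List.mem_append.1 hK with h1 | h1
      · have hKH : IsEmpty (K ⟶ H) := ⟨fun α => hs.2.2 K h1 H (by simp)
          ⟨⟨α⟩, hn.2.2 K h1 H (by simp)⟩⟩
        rw [hh K h1, NatTrans.comp_app, ht' K hKH, Limits.comp_zero, sub_zero]
      · rw [List.mem_singleton.1 h1, ht, sub_self]
  obtain ⟨h, hh⟩ := key L List.prefix_rfl
  suffices hz : f - g ≫ h = 0 from ⟨h, (sub_eq_zero.1 hz).symm⟩
  refine NatTrans.ext (funext fun K => ?_)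
  obtain ⟨K', hK', ⟨i⟩⟩ := hL.complete K
  have h2 := (f - g ≫ h).naturality i.inv
  rw [hh K' hK', Limits.comp_zero] at h2
  exact Limits.zero_of_comp_mono _ h2.symm

theorem isInjective_envelope {L : List (OrbitCat G)} (hL : IsEnlargementOrder L)
    (U : DGADiagram G) : IsInjective (DGADiagram.envelope L U) :=
  isInjective_of_extendsFrom hL fun _ hH => extendsFrom_envelope hL.sorted U hH

end injective

end DGADiagram

/-! ### The two implications. -/

theorem mainTheorem9 {G : Type u} [Group G] [Finite G]
    (L : List (OrbitCat G)) (hL : DGADiagram.IsEnlargementOrder L)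
    (M N : DGADiagram G)
    (hM : ∀ K, (M.obj K).IsMinimal) (hN : ∀ K, (N.obj K).IsMinimal)
    (hMN : ∀ K, CDGA.SameCohomology (M.obj K) (N.obj K)) :
    (DGADiagram.WeaklyEquivalent (DGADiagram.envelope L M) (DGADiagram.envelope L N) →
      ∀ K, CDGA.SameRationalHomotopyType (M.obj K) (N.obj K)) ∧
    ∀ r : M ⟶ N, (∀ K, CDGA.IsQuasiIso (r.app K)) →
      (∃ φ : DGADiagram.envelope L M ⟶ DGADiagram.envelope L N,
        DGADiagram.envelopeIncl L M ≫ φ = r ≫ DGADiagram.envelopeIncl L N ∧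
          DGADiagram.IsQuasiIso φ) ∧
      DGADiagram.WeaklyEquivalent (DGADiagram.envelope L M) (DGADiagram.envelope L N) := by
  refine ⟨fun h K => ?_, fun r hr => ?_⟩
  · refine .trans _ _ _ (.rel _ _ ⟨_, DGADiagram.isQuasiIso_envelopeIncl L M K⟩)
      (.trans _ _ _ (h.sameRationalHomotopyType K)
        (.symm _ _ (.rel _ _ ⟨_, DGADiagram.isQuasiIso_envelopeIncl L N K⟩)))
  · obtain ⟨φ, hφ⟩ := DGADiagram.exists_envelopeHom L r
    have hq : DGADiagram.IsQuasiIso φ := fun K =>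
      -- Two-out-of-three in the commutative square of `φ`, `r` and the two inclusions.
      (DGADiagram.isQuasiIso_envelopeIncl L M K).of_comp_left (by
        rw [← NatTrans.comp_app, hφ, NatTrans.comp_app]
        exact (hr K).comp (DGADiagram.isQuasiIso_envelopeIncl L N K))
    exact ⟨⟨φ, hφ, hq⟩, .rel _ _ ⟨DGADiagram.isInjective_envelope hL M,
      DGADiagram.isInjective_envelope hL N, φ, hq⟩⟩
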